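/- **Setting.** Let $\Gamma$ be a countable group, $A$ a finite set, and let $\Gamma$ act on $A^\Gamma$ by $(g\cdot x)(h)=x(hg)$. Let $X\subseteq A^\Gamma$ be a subshift (closed and shift-invariant), $u\colon X\to\mathbb R$ continuous, and $\tilde u\colon A^\Gamma\to\mathbb R$ a continuous extension of $u$. $\mathrm{Prob}(\cdot)$ denotes Borel probability measures with the weak* topology, and $\mathrm{Prob}^\Gamma(X)$ the shift-invariant ones carried by $X$. For a nonempty finite set $V$, $\sigma\colon\Gamma\to\mathrm{Sym}(V)$ and $x\in A^V$ put $\Pi^\sigma_v x(\gamma)=x(\sigma(\gamma)v)$ and $P^\sigma_x=\frac1{|V|}\sum_{v}\delta_{\Pi^\sigma_v x}$. For $\zeta\in\mathrm{Prob}(A^V)$ put $P^\sigma_\zeta=\sum_x\zeta\{x\}P^\sigma_x$. For $O\subseteq\mathrm{Prob}(A^\Gamma)$ put $\Omega(\sigma,O)=\{x\in A^V: P_x^\sigma\in O\}$ and $\mathbf\Omega(\sigma,O)=\{\zeta\in\mathrm{Prob}(A^V): P_\zeta^\sigma\in O\}$. Let $\tilde U^\sigma(x)=\sum_v\tilde u(\Pi_v^\sigma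 x)$ and $\tilde P^\sigma(\zeta)=H(\zeta)-\sum_x\zeta\{x\}\tilde U^\sigma(x)$, where $H$ is Shannon entropy. If $\Omega(\sigma,U)\ne\emptyset$, the restricted Gibbs state $\xi_\sigma^U\in\mathrm{Prob}(A^V)$ gives each $x\in\Omega(\sigma,U)$ a mass proportional to $e^{-\tilde U^\sigma(x)}$ and all other $x$ mass $0$. A map $\sigma$ is $(F,\delta)$-sofic if more than $(1-\delta)|V|$ points $v$ satisfy $\sigma(\gamma)v\neq v$ for all $\gamma\in F\setminus\{1\}$, and more than $(1-\delta)|V|$ points satisfy $\sigma(\gamma_1\gamma_2)v=\sigma(\gamma_1)\sigma(\gamma_2)v$ for all $\gamma_1,\gamma_2\in F$. A random sofic approximation $\Sigma$ is a sequence of random maps $\sigma_n\colon\Gamma\to\mathrm{Sym}(V_n)$ with $|V_n|\to\infty$ such that for all finite $F\subset\Gamma$ and all $\delta,c>0$, $\mathbb P(\sigma_n\text{ is }(F,\delta)\text{-sofic})>1-e^{-cn}$ for all large $n$. Put $$h_\Sigma(\mu)=\inf_{O\ni\mu\text{ open}}\limsup_{n}\frac1{|V_n|}\log\mathbb E|\Omega(\sigma_n,O)|\in[-\infty,\infty),\qquad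 \mathrm P_\Sigma(\mu)=h_\Sigma(\mu)-\int_X u\,d\mu .$$ A measure $\nu\in\mathrm{Prob}^\Gamma(X)$ is $\Sigma$-equilibrium if it maximizes $\mathrm P_\Sigma$ over $\mathrm{Prob}^\Gamma(X)$. Below, $\lim$ and $\limsup$ as $U\downarrow\mathrm{Prob}^\Gamma(X)$ are over the directed set of open neighbourhoods $U$ of $\mathrm{Prob}^\Gamma(X)$ in $\mathrm{Prob}(A^\Gamma)$, and $\xi_n^U=\xi_{\sigma_n}^U$. We say that $\bar\mu\in\mathrm{Prob}(A^\Gamma)$ is the local weak limit of the finitary Gibbs states over $\Sigma$ if for every open $O\ni\bar\mu$ $$\limsup_{U\downarrow \mathrm{Prob}^\Gamma(X)}\limsup_{n}\frac1{|V_n|}\log\mathbb P\{\xi_n^U\notin\mathbf\Omega(\sigma_n,O)\}=-\infty ,$$ where the event includes the case that $\xi^U_n$ does not exist, i.e. $\Omega(\sigma_n,U)=\emptyset$. In that case we also read $\exp\tilde P^{\sigma_n}(\xi_n^U)$ as $0$. The ergodic decomposition of an invariant $\mu$ is the probability measure $\theta$ on $\mathrm{Prob}^\Gamma(A^\Gamma)$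 with barycenter $\mu$ (i.e. $\mu(f)=\int\nu(f)\,\theta(d\nu)$ for all continuous $f$) that vanishes on every measurable set containing no ergodic measure. $\Sigma$ is good if $h_\Sigma(\mu)\le\int h_\Sigma\,d\theta$ for every $\mu\in\mathrm{Prob}^\Gamma(A^\Gamma)$ with ergodic decomposition $\theta$. **Theorem.** Let $\Sigma$ be a random sofic approximation to $\Gamma$, and suppose that the finitary Gibbs states (defined with $\tilde u$) have local weak limit $\bar\mu$ over $\Sigma$. Then: 1. There is a probability measure $\mathfrak p$ on $\mathrm{Prob}^\Gamma(X)$ with barycenter $\bar\mu$ such that $\mathfrak p$-a.e. $\nu$ is $\Sigma$-equilibrium. 2. The function $\mathrm P_\Sigma$ attains a maximum on $\mathrm{Prob}^\Gamma(X)$, and its maximal value is $$\lim_{U\downarrow\mathrm{Prob}^\Gamma(X)}\ \limsup_{n\to\infty}\frac1{|V_n|}\log\mathbb E\exp\{\tilde P^{\sigma_n}(\xi_n^U)\}$$ (in particular this limit exists). 3. If $\Sigma$ is good, then the ergodic decomposition of $\bar\mu$ (exists and) gives full measure to the set of $\Sigma$-equilibrium measures. -/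

import Mathlib

open MeasureTheory Filter Topology
open scoped ENNReal

noncomputable section

namespace SoficPressure

/-! ### The shift action, subshifts, invariant and ergodic measures -/

section Shift

variable {Γ A : Type*} [Group Γ]

/-- The shift action of `Γ` on `A^Γ`: `(g · x)(h) = x (h g)`. This is the (left) action with respect
to which the pullback names below are asymptotically equivariant. -/
def shift (g : Γ) (x : Γ → A) : Γ → A := fun h => x (h * g)

/-- A subshift: a closed, shift-invariant subset of `A^Γ`. -/
def IsSubshift [TopologicalSpace A] (X : Set (Γ → A)) : Prop :=
  IsClosed X ∧ ∀ g : Γ, ∀ x ∈ X, shift g x ∈ X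

variable [MeasurableSpace A]

/-- Shift-invariance of a Borel probability measure on `A^Γ`. -/
def IsInvariant (μ : ProbabilityMeasure (Γ → A)) : Prop :=
  ∀ g : Γ, (μ : Measure (Γ → A)).map (shift g) = μ

/-- Ergodicity (this includes invariance). -/
def IsErgodic (μ : ProbabilityMeasure (Γ → A)) : Prop :=
  IsInvariant μ ∧ ∀ E : Set (Γ → A), MeasurableSet E → (∀ g : Γ, shift g ⁻¹' E = E) →
    (μ : Measure (Γ → A)) E = 0 ∨ (μ : Measure (Γ → A)) E = 1

/-- `Prob^Γ(X)`: the shift-invariant Borel probability measures on `A^Γ` that are carried by `X`. -/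
def invProb (X : Set (Γ → A)) : Set (ProbabilityMeasure (Γ → A)) :=
  {μ | IsInvariant μ ∧ ∀ᵐ x ∂(μ : Measure (Γ → A)), x ∈ X}

/-- `μ` is the barycenter of the measure `p` on the space of probability measures:
`μ(f) = ∫ ν(f) p(dν)` for every continuous `f`. -/
def IsBarycenter [TopologicalSpace A] (p : Measure (ProbabilityMeasure (Γ → A)))
    (μ : ProbabilityMeasure (Γ → A)) : Prop :=
  ∀ f : C(Γ → A, ℝ), ∫ x, f x ∂(μ : Measure (Γ → A)) =
    ∫ ν, (∫ x, f x ∂((ν : ProbabilityMeasure (Γ → A)) : Measure (Γ → A))) ∂p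

/-- `θ` is the ergodic decomposition of `μ`: a probability measure on the space of invariant
probability measures which has barycenter `μ` and vanishes on every measurable set containing no
ergodic measure. -/
structure IsErgodicDecomposition [TopologicalSpace A]
    (θ : Measure (ProbabilityMeasure (Γ → A))) (μ : ProbabilityMeasure (Γ → A)) : Prop where
  prob : IsProbabilityMeasure θ
  invariant : ∀ᵐ ν ∂θ, IsInvariant ν
  barycenter : IsBarycenter θ μ
  ergodic : ∀ E : Set (ProbabilityMeasure (Γ → A)), MeasurableSet E →
    (∀ ν ∈ E, ¬ IsErgodic ν) → θ E = 0

end Shift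

/-! ### Extended-real integrals and the directed set of open neighbourhoods -/

/-- The integral `∫ f⁺ - ∫ f⁻` of an extended-real valued function. It is used only for functions
that are bounded above. -/
def eintegral {S : Type*} [MeasurableSpace S] (θ : Measure S) (f : S → EReal) : EReal :=
  ((∫⁻ s, (f s).toENNReal ∂θ : ℝ≥0∞) : EReal) - ((∫⁻ s, (-f s).toENNReal ∂θ : ℝ≥0∞) : EReal)

/-- The filter of "`U ↓ K`": its basic sets are `{U : U open, K ⊆ U ⊆ U₀}`, where `U₀` is an open
neighbourhood of `K`. Limits and upper limits along it are those over the directed set of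
open neighbourhoods of `K`. -/
def openNhds {S : Type*} [TopologicalSpace S] (K : Set S) : Filter (Set S) :=
  ⨅ U₀ ∈ {U : Set S | IsOpen U ∧ K ⊆ U}, 𝓟 {U | IsOpen U ∧ K ⊆ U ∧ U ⊆ U₀}

/-! ### Microstates over a map `σ : Γ → Sym(V)` -/

section Finite

variable {Γ A V : Type*}

/-- The pullback name `Π_v^σ x (γ) = x (σ(γ) v)`. -/
def pullbackName (σ : Γ → Equiv.Perm V) (x : V → A) (v : V) : Γ → A := fun γ => x (σ γ v)

/-- `σ` is `(F, δ)`-sofic: almost free and almost an action. -/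
def IsSofic [Group Γ] [Fintype V] (F : Finset Γ) (δ : ℝ) (σ : Γ → Equiv.Perm V) : Prop :=
  1 - δ < ({v : V | ∀ γ ∈ F, γ ≠ 1 → σ γ v ≠ v}.ncard : ℝ) / Fintype.card V ∧
  1 - δ < ({v : V | ∀ γ₁ ∈ F, ∀ γ₂ ∈ F, σ (γ₁ * γ₂) v = σ γ₁ (σ γ₂ v)}.ncard : ℝ) /
    Fintype.card V

variable [Fintype V] [Nonempty V]

/-- The empirical distribution `P_x^σ`, the law of `Π_v^σ x` for a uniformly random `v`. -/
def empirical [MeasurableSpace A] (σ : Γ → Equiv.Perm V) (x : V → A) :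
    ProbabilityMeasure (Γ → A) :=
  ⟨((PMF.uniformOfFintype V).map (pullbackName σ x)).toMeasure, inferInstance⟩

/-- The average empirical distribution `P_ζ^σ = ∑ₓ ζ{x} P_x^σ`. -/
def avgEmpirical [MeasurableSpace A] (σ : Γ → Equiv.Perm V) (ζ : PMF (V → A)) :
    ProbabilityMeasure (Γ → A) :=
  ⟨(ζ.bind fun x => (PMF.uniformOfFintype V).map (pullbackName σ x)).toMeasure, inferInstance⟩

/-- `Ω(σ, O)`: the microstates whose empirical distribution lies in `O`. -/
def microstates [MeasurableSpace A] (σ : Γ → Equiv.Perm V)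
    (O : Set (ProbabilityMeasure (Γ → A))) : Set (V → A) :=
  {x | empirical σ x ∈ O}

/-- `𝛀(σ, O)`: the laws of random microstates whose average empirical distribution lies in `O`. -/
def randomMicrostates [MeasurableSpace A] (σ : Γ → Equiv.Perm V)
    (O : Set (ProbabilityMeasure (Γ → A))) : Set (PMF (V → A)) :=
  {ζ | avgEmpirical σ ζ ∈ O}

/-- The total energy `Ũ^σ(x) = ∑_v ũ(Π_v^σ x)` of a microstate. -/
def totalEnergy (w : (Γ → A) → ℝ) (σ : Γ → Equiv.Perm V) (x : V → A) : ℝ :=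
  ∑ v, w (pullbackName σ x v)

/-- The Shannon entropy of a law on a finite set. -/
def shannonEntropy {S : Type*} (ζ : PMF S) : ℝ := ∑' s, Real.negMulLog (ζ s).toReal

/-- The pressure `P̃^σ(ζ) = H(ζ) - Ũ^σ(ζ)` of the law `ζ` of a random microstate, where `Ũ^σ(ζ)` is
the average energy. -/
def finPressure (w : (Γ → A) → ℝ) (σ : Γ → Equiv.Perm V) (ζ : PMF (V → A)) : ℝ :=
  shannonEntropy ζ - ∑' x, (ζ x).toReal * totalEnergy w σ x

open Classical in
/-- The unnormalised weights `exp (-Ũ^σ(x)) 1_{x ∈ Ω(σ, U)}` of the restricted Gibbs state. -/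
def gibbsWeight [MeasurableSpace A] (w : (Γ → A) → ℝ) (σ : Γ → Equiv.Perm V)
    (U : Set (ProbabilityMeasure (Γ → A))) (x : V → A) : ℝ≥0∞ :=
  if x ∈ microstates σ U then ENNReal.ofReal (Real.exp (-totalEnergy w σ x)) else 0

theorem gibbsWeight_tsum_ne_zero [MeasurableSpace A] (w : (Γ → A) → ℝ) (σ : Γ → Equiv.Perm V)
    (U : Set (ProbabilityMeasure (Γ → A))) (h : (microstates σ U).Nonempty) :
    ∑' x, gibbsWeight w σ U x ≠ 0 := by
  obtain ⟨x, hx⟩ := h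
  intro h0
  have h1 := ENNReal.tsum_eq_zero.1 h0 x
  simp only [gibbsWeight, hx, if_true, ENNReal.ofReal_eq_zero] at h1
  exact absurd (Real.exp_pos _) (not_lt.2 h1)

theorem gibbsWeight_tsum_ne_top [Finite A] [MeasurableSpace A] (w : (Γ → A) → ℝ)
    (σ : Γ → Equiv.Perm V) (U : Set (ProbabilityMeasure (Γ → A))) :
    ∑' x, gibbsWeight w σ U x ≠ ∞ := by
  classical
  have := Fintype.ofFinite A
  rw [tsum_fintype]
  refine ENNReal.sum_ne_top.2 fun x _ => ?_
  unfold gibbsWeight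
  split_ifs
  · exact ENNReal.ofReal_ne_top
  · exact ENNReal.zero_ne_top

/-- The restricted finitary Gibbs state
`ξ_σ^U {x} = Z⁻¹ exp (-Ũ^σ(x)) 1_{x ∈ Ω(σ, U)}`. It exists only if `Ω(σ, U)` is not empty. -/
def gibbsState [Finite A] [MeasurableSpace A] (w : (Γ → A) → ℝ) (σ : Γ → Equiv.Perm V)
    (U : Set (ProbabilityMeasure (Γ → A))) (h : (microstates σ U).Nonempty) : PMF (V → A) :=
  PMF.normalize (gibbsWeight w σ U) (gibbsWeight_tsum_ne_zero w σ U h)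
    (gibbsWeight_tsum_ne_top w σ U)

open Classical in
/-- `exp (P̃^σ(ξ_σ^U))`. If `Ω(σ, U)` is empty, then the maximal pressure of a law on `Ω(σ, U)`
is a supremum over the empty set, i.e. `-∞`, and its exponential is `0`. -/
def expGibbsPressure [Finite A] [MeasurableSpace A] (w : (Γ → A) → ℝ) (σ : Γ → Equiv.Perm V)
    (U : Set (ProbabilityMeasure (Γ → A))) : ℝ≥0∞ :=
  if h : (microstates σ U).Nonempty then
    ENNReal.ofReal (Real.exp (finPressure w σ (gibbsState w σ U h)))
  else 0


end Finite

/-! ### Random sofic approximations, sofic entropy and pressure -/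

section Random

variable {Γ A S : Type*} [MeasurableSpace S] {V : ℕ → Type*} [∀ n, Fintype (V n)]

/-- A random sofic approximation: random maps `σ n : Γ → Sym(V n)`, with `|V n| → ∞`, such
that for all `F`, `δ`, `c` the map `σ n` is `(F, δ)`-sofic with probability greater than
`1 - e^{-cn}` for all large `n`. The randomness is carried by a probability space `(S, P)`. -/
structure IsRandomSoficApprox [Group Γ] (P : Measure S) (σ : ∀ n, S → Γ → Equiv.Perm (V n)) :
    Prop where
  measurable : ∀ (n : ℕ) (γ : Γ) (τ : Equiv.Perm (V n)), MeasurableSet {s | σ n s γ = τ}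
  card_tendsto : Tendsto (fun n => Fintype.card (V n)) atTop atTop
  sofic : ∀ (F : Finset Γ) (δ c : ℝ), 0 < δ → 0 < c →
    ∀ᶠ n : ℕ in atTop, 1 - Real.exp (-c * n) < P.real {s | IsSofic F δ (σ n s)}

variable [∀ n, Nonempty (V n)] [Countable Γ] [Finite A] [TopologicalSpace A]
  [DiscreteTopology A] [MeasurableSpace A] [BorelSpace A]

/-- The upper exponential growth rate `limsup_n (1/|V n|) log a n`, with values in `[-∞, ∞]`. -/
def growthRate (V : ℕ → Type*) [∀ n, Fintype (V n)] (a : ℕ → ℝ≥0∞) : EReal :=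
  limsup (fun n => ENNReal.log (a n) / ((Fintype.card (V n) : ℝ) : EReal)) atTop

/-- The sofic entropy
`h_Σ(μ) = inf_{O ∋ μ open} limsup_n (1/|V n|) log 𝔼 |Ω(σ n, O)|`, with values in `[-∞, ∞]`. -/
def soficEntropy (P : Measure S) (σ : ∀ n, S → Γ → Equiv.Perm (V n))
    (μ : ProbabilityMeasure (Γ → A)) : EReal :=
  ⨅ O ∈ {O : Set (ProbabilityMeasure (Γ → A)) | IsOpen O ∧ μ ∈ O},
    growthRate V fun n => ∫⁻ s, ((microstates (σ n s) O).ncard : ℝ≥0∞) ∂P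

/-- The pressure `h_Σ(μ) - u(μ)`, with `u(μ) = ∫_X u dμ` the energy density of `μ`. -/
def soficPressure (P : Measure S) (σ : ∀ n, S → Γ → Equiv.Perm (V n)) (X : Set (Γ → A))
    (u : (Γ → A) → ℝ) (μ : ProbabilityMeasure (Γ → A)) : EReal :=
  soficEntropy P σ μ - ((∫ x in X, u x ∂(μ : Measure (Γ → A)) : ℝ) : EReal)

variable [Group Γ]

/-- `ν` is a `Σ`-equilibrium measure: it maximizes the pressure on `Prob^Γ(X)`. -/
def IsEquilibrium (P : Measure S) (σ : ∀ n, S → Γ → Equiv.Perm (V n)) (X : Set (Γ → A))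
    (u : (Γ → A) → ℝ) (ν : ProbabilityMeasure (Γ → A)) : Prop :=
  ν ∈ invProb X ∧ ∀ ν' ∈ invProb X, soficPressure P σ X u ν' ≤ soficPressure P σ X u ν

/-- `Σ` is good (for the alphabet `A`): `h_Σ(μ) ≤ ∫ h_Σ(ν) θ(dν)` for every invariant `μ` with
ergodic decomposition `θ`. -/
def IsGood (A : Type*) [Finite A] [TopologicalSpace A] [DiscreteTopology A] [MeasurableSpace A]
    [BorelSpace A] (P : Measure S) (σ : ∀ n, S → Γ → Equiv.Perm (V n)) : Prop :=
  ∀ μ : ProbabilityMeasure (Γ → A), IsInvariant μ →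
    ∀ θ : Measure (ProbabilityMeasure (Γ → A)), IsErgodicDecomposition θ μ →
      soficEntropy P σ μ ≤ eintegral θ (soficEntropy P σ)

/-- `lwlim(u, Σ) = μ`, where `w` is the chosen continuous extension of `u` to `A^Γ`: for every open
`O ∋ μ`, `limsup_{U ↓ Prob^Γ(X)} limsup_n (1/|V n|) log ℙ{ξ_n^U ∉ 𝛀(σ n, O)} = -∞`. When `ξ_n^U` does
not exist because `Ω(σ n, U)` is empty, it does not belong to `𝛀(σ n, O)`. -/
def IsLocalWeakLimit (P : Measure S) (σ : ∀ n, S → Γ → Equiv.Perm (V n)) (X : Set (Γ → A))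
    (w : (Γ → A) → ℝ) (μ : ProbabilityMeasure (Γ → A)) : Prop :=
  ∀ O : Set (ProbabilityMeasure (Γ → A)), IsOpen O → μ ∈ O →
    limsup (fun U : Set (ProbabilityMeasure (Γ → A)) =>
      growthRate V fun n => P {s | ¬ ∃ h : (microstates (σ n s) U).Nonempty,
        gibbsState w (σ n s) U h ∈ randomMicrostates (σ n s) O})
      (openNhds (invProb X)) = ⊥

end Random

end SoficPressure

end

open SoficPressure

/-! The restricted Gibbs state has pressure `log Z(U)`, where `Z(U)` is its partition function, so
everything reduces to `G(U)`, the exponential growth rate of `𝔼 Z(U)` (`gibbsRate`). `G` is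
monotone, and the rate of a union is governed by the larger of the two rates. Near `ν` the energy
per site is almost `∫ w dν`, so the infimum of `G` over the neighbourhoods of `ν` is `h_Σ(ν) - ∫ w
dν` (`localValue_gibbsRate`), which is the pressure when `ν ∈ Prob^Γ(X)`. This local value is upper
semicontinuous; compactness of `Prob^Γ(X)` gives a maximum `m` equal to the limit of `G(U)`. It is
finite: entropy and energy are bounded, and the hypothesis makes microstates exist with probability
at least 1/2.

For the equilibrium decomposition, let `N` be a neighbourhood of the maximizers. The rest of
`Prob^Γ(X)` is covered by an open `U₁` with `G(U₁) < m`, and the Gibbs state puts mass at most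
`Z(U₁)/Z(U)` on microstates with empirical measure off `N`. If this mass exceeded `δ` for every map
whose average empirical measure is near `μ`, then `Z(U)` would be at most `δ⁻¹ Z(U₁)` off the bad
event, whose probability is small enough to beat the bound on `Z`; integrating contradicts `G(U) ≥
m`. So some map gives a law of empirical measures with barycenter near `μ` and nearly concentrated
on `N` (`IsLocalWeakLimit.exists_bary_mem`), and a weak* limit of such laws is the required `p`
(`exists_bary_eq_of_approx`).

For good `Σ`, energy is affine and entropy is at most the mean entropy of the ergodic components, so
almost all components of a maximizer must be maximizers. One disintegration `κ` serves both `μ` and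
`p`-almost every `ν` (`IsInvariant.exists_ergodic_disintegration`), which transfers this from the
`ν` to `μ`. -/

noncomputable section

namespace SoficPressure

/-! ### Borel structure and barycenters on the space of probability measures -/

section Borel

variable {Ω : Type*} [TopologicalSpace Ω] [CompactSpace Ω] [TopologicalSpace.MetrizableSpace Ω]
  [MeasurableSpace Ω] [BorelSpace Ω]

omit [CompactSpace Ω] in
-- By the portmanteau theorem, evaluation at a closed set is upper semicontinuous; closed sets form
-- a π-system generating the Borel sets.
theorem measurable_probabilityMeasure_apply_of_borel {B : Set Ω} (hB : MeasurableSet B) :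
    Measurable[borel (ProbabilityMeasure Ω)] fun ν : ProbabilityMeasure Ω => (ν : Measure Ω) B := by
  let _ : MeasurableSpace (ProbabilityMeasure Ω) := borel _
  have : BorelSpace (ProbabilityMeasure Ω) := ⟨rfl⟩
  have h : Measurable fun ν : ProbabilityMeasure Ω => (ν : Measure Ω) := by
    refine Measurable.measure_of_isPiSystem_of_isProbabilityMeasure (S := {s | IsClosed s})
      (by rw [BorelSpace.measurable_eq (α := Ω), borel_eq_generateFrom_isClosed])
      isPiSystem_isClosed fun F hF => ?_
    refine UpperSemicontinuous.measurable ?_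
    intro ν c hc
    have := ProbabilityMeasure.limsup_measure_closed_le_of_tendsto (L := 𝓝 ν) (μ := ν)
      (μs := id) tendsto_id hF
    exact Filter.eventually_lt_of_limsup_lt (lt_of_le_of_lt this hc)
  exact (Measure.measurable_coe hB).comp h

omit [CompactSpace Ω] [TopologicalSpace.MetrizableSpace Ω] in
theorem topology_probabilityMeasure_eq_generateFrom :
    (inferInstance : TopologicalSpace (ProbabilityMeasure Ω)) = TopologicalSpace.generateFrom
      {U | ∃ (f : BoundedContinuousFunction Ω NNReal) (W : Set ℝ≥0∞), IsOpen W ∧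
        U = (fun ν : ProbabilityMeasure Ω => ∫⁻ x, f x ∂(ν : Measure Ω)) ⁻¹' W} := by
  apply le_antisymm
  · refine le_generateFrom ?_
    rintro U ⟨f, W, hW, rfl⟩
    exact hW.preimage (ProbabilityMeasure.continuous_lintegral_boundedContinuousFunction f)
  · rw [← continuous_id_iff_le]
    refine (@ProbabilityMeasure.continuous_iff_forall_continuous_lintegral Ω
      _ _ _ (ProbabilityMeasure Ω) (_) id).2 fun f => ?_
    let _ := TopologicalSpace.generateFrom
      {U | ∃ (f : BoundedContinuousFunction Ω NNReal) (W : Set ℝ≥0∞), IsOpen W ∧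
        U = (fun ν : ProbabilityMeasure Ω => ∫⁻ x, f x ∂(ν : Measure Ω)) ⁻¹' W}
    refine continuous_def.2 fun W hW => ?_
    exact TopologicalSpace.isOpen_generateFrom_of_mem ⟨f, W, hW, rfl⟩

/-- The σ-algebra generated by evaluations is the Borel σ-algebra of the weak* topology. The
converse inclusion needs second countability, so that a subbasis of integral conditions already
generates all Borel sets. -/
instance borelSpace_probabilityMeasure : BorelSpace (ProbabilityMeasure Ω) := by
  constructor
  apply le_antisymm
  · suffices h : @Measurable _ _ (borel (ProbabilityMeasure Ω)) _ (id : ProbabilityMeasure Ω → _) by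
      intro s hs
      exact h hs
    refine @Measurable.subtype_mk _ _ (borel (ProbabilityMeasure Ω)) _ _ Subtype.val ?_ _
    refine @Measure.measurable_of_measurable_coe _ _ _ (_) _ fun B hB => ?_
    exact measurable_probabilityMeasure_apply_of_borel hB
  · let _ := TopologicalSpace.metrizableSpaceMetric (ProbabilityMeasure Ω)
    have : SecondCountableTopology (ProbabilityMeasure Ω) := inferInstance
    rw [borel_eq_generateFrom_of_subbasis topology_probabilityMeasure_eq_generateFrom]
    refine MeasurableSpace.generateFrom_le ?_
    rintro U ⟨f, W, hW, rfl⟩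
    refine ((Measure.measurable_lintegral ?_).comp measurable_subtype_coe) hW.measurableSet
    exact measurable_coe_nnreal_ennreal.comp f.continuous.measurable

theorem measurable_toMeasure {Ω : Type*} [MeasurableSpace Ω] :
    Measurable fun ν : ProbabilityMeasure Ω => (ν : Measure Ω) :=
  measurable_subtype_coe

theorem measurable_probabilityMeasure_apply {Ω : Type*} [MeasurableSpace Ω] {B : Set Ω}
    (hB : MeasurableSet B) :
    Measurable fun ν : ProbabilityMeasure Ω => (ν : Measure Ω) B :=
  (Measure.measurable_coe hB).comp measurable_toMeasure

/-- The barycenter of a probability measure on the space of probability measures. -/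
def bary {Ω : Type*} [MeasurableSpace Ω] (q : ProbabilityMeasure (ProbabilityMeasure Ω)) :
    ProbabilityMeasure Ω :=
  ⟨(q : Measure (ProbabilityMeasure Ω)).bind fun ν => (ν : Measure Ω),
    isProbabilityMeasure_bind measurable_toMeasure.aemeasurable
      (Eventually.of_forall fun _ => inferInstance)⟩

theorem integral_bind_toMeasure (p : Measure (ProbabilityMeasure Ω)) [IsFiniteMeasure p]
    (f : C(Ω, ℝ)) :
    ∫ x, f x ∂(p.bind fun ν => (ν : Measure Ω)) = ∫ ν, (∫ x, f x ∂(ν : Measure Ω)) ∂p := by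
  let κ : ProbabilityTheory.Kernel (ProbabilityMeasure Ω) Ω := ⟨fun ν => (ν : Measure Ω), measurable_toMeasure⟩
  have : ProbabilityTheory.IsMarkovKernel κ := ⟨fun ν => inferInstanceAs (IsProbabilityMeasure (ν : Measure Ω))⟩
  have hf : Integrable f (p.bind κ) := by
    have : IsFiniteMeasure (p.bind κ) := inferInstance
    exact f.continuous.integrable_of_hasCompactSupport (HasCompactSupport.of_compactSpace _)
  rw [Measure.comp_eq_comp_const_apply] at hf
  have h := ProbabilityTheory.Kernel.integral_comp hf
  rwa [← Measure.comp_eq_comp_const_apply] at h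

theorem continuous_bary : Continuous (bary (Ω := Ω)) := by
  let _ := TopologicalSpace.metrizableSpaceMetric (ProbabilityMeasure Ω)
  refine ProbabilityMeasure.continuous_iff_forall_continuousMap_continuous_integral.2 fun f => ?_
  have h : (fun q : ProbabilityMeasure (ProbabilityMeasure Ω) => ∫ x, f x ∂(bary q : Measure Ω)) =
      fun q : ProbabilityMeasure (ProbabilityMeasure Ω) =>
        ∫ ν, (∫ x, f x ∂(ν : Measure Ω)) ∂(q : Measure (ProbabilityMeasure Ω)) := by
    funext q
    exact integral_bind_toMeasure _ f
  rw [h]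
  exact ProbabilityMeasure.continuous_integral_continuousMap
    (⟨fun ν : ProbabilityMeasure Ω => ∫ x, f x ∂(ν : Measure Ω),
      ProbabilityMeasure.continuous_integral_continuousMap f⟩ : C(ProbabilityMeasure Ω, ℝ))

/-- A probability measure that can be approximated by barycenters of measures almost concentrated
near the closed set `F` is the barycenter of a measure concentrated on `F`. -/
theorem exists_bary_eq_of_approx {F : Set (ProbabilityMeasure Ω)} (hF : IsClosed F)
    {μ : ProbabilityMeasure Ω}
    (h : ∀ O N : Set (ProbabilityMeasure Ω), IsOpen O → μ ∈ O → IsOpen N → F ⊆ N →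
      ∀ δ : ℝ≥0∞, 0 < δ → ∃ q : ProbabilityMeasure (ProbabilityMeasure Ω),
        bary q ∈ O ∧ (q : Measure (ProbabilityMeasure Ω)) Nᶜ ≤ δ) :
    ∃ p : ProbabilityMeasure (ProbabilityMeasure Ω), bary p = μ ∧
      (p : Measure (ProbabilityMeasure Ω)) Fᶜ = 0 := by
  let _ := TopologicalSpace.metrizableSpaceMetric (ProbabilityMeasure Ω)
  let r : ℕ → ℝ := fun k => 1 / ((k : ℝ) + 1)
  have hr : ∀ k, 0 < r k := fun k => Nat.one_div_pos_of_nat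
  have hr0 : Tendsto r atTop (𝓝 0) := tendsto_one_div_add_atTop_nhds_zero_nat
  choose q hq1 hq2 using fun k : ℕ => h (Metric.ball μ (r k)) (Metric.thickening (r k) F)
    Metric.isOpen_ball (Metric.mem_ball_self (hr k)) Metric.isOpen_thickening
    (Metric.self_subset_thickening (hr k) F) (ENNReal.ofReal (r k)) (ENNReal.ofReal_pos.2 (hr k))
  obtain ⟨p, φ, hφ, hp⟩ := CompactSpace.tendsto_subseq q
  refine ⟨p, ?_, ?_⟩
  · refine tendsto_nhds_unique ((continuous_bary.tendsto p).comp hp) ?_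
    rw [tendsto_iff_dist_tendsto_zero]
    refine squeeze_zero (fun _ => dist_nonneg) (fun k => ?_) (hr0.comp hφ.tendsto_atTop)
    exact (Metric.mem_ball.1 (hq1 (φ k))).le
  -- Portmanteau for the open complement of a closed thickening: its mass under `p` is at most the
  -- liminf of masses bounded by `r (φ k)`, which tend to 0.
  · have key : ∀ j, (p : Measure (ProbabilityMeasure Ω)) (Metric.cthickening (r j) F)ᶜ = 0 := by
      intro j
      have h1 := ProbabilityMeasure.le_liminf_measure_open_of_tendsto hp
        (Metric.isClosed_cthickening (δ := r j) (E := F)).isOpen_compl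
      have h2 : Tendsto (fun k => ((q ∘ φ) k : Measure (ProbabilityMeasure Ω))
          (Metric.cthickening (r j) F)ᶜ) atTop (𝓝 0) := by
        have h3 : Tendsto (fun k => ENNReal.ofReal (r (φ k))) atTop (𝓝 0) := by
          simpa using ENNReal.tendsto_ofReal (hr0.comp hφ.tendsto_atTop)
        refine tendsto_of_tendsto_of_tendsto_of_le_of_le' tendsto_const_nhds h3
          (Eventually.of_forall fun _ => zero_le) ?_
        filter_upwards [(hr0.comp hφ.tendsto_atTop).eventually (gt_mem_nhds (hr j))] with k hk
        refine le_trans (measure_mono (Set.compl_subset_compl.2 ?_)) (hq2 (φ k))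
        exact (Metric.thickening_mono hk.le F).trans (Metric.thickening_subset_cthickening _ _)
      rw [h2.liminf_eq] at h1
      exact le_antisymm h1 (zero_le)
    have h5 : Fᶜ ⊆ ⋃ j, (Metric.cthickening (r j) F)ᶜ := by
      intro ν hν
      by_contra hc
      simp only [Set.mem_iUnion, Set.mem_compl_iff, not_exists, not_not] at hc
      refine hν ?_
      rw [← hF.closure_eq, Metric.closure_eq_iInter_cthickening' F (Set.range r)]
      · simpa using hc
      · intro ε hε
        obtain ⟨k, hk⟩ := exists_nat_one_div_lt hε
        exact ⟨r k, ⟨k, rfl⟩, hr k, hk.le⟩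
    exact measure_mono_null h5 (measure_iUnion_null key)

/-- The barycenter relation for continuous functions extends to all measurable sets. -/
theorem bind_eq_of_integral_eq {p : Measure (ProbabilityMeasure Ω)} [IsProbabilityMeasure p]
    {μ : ProbabilityMeasure Ω}
    (h : ∀ f : C(Ω, ℝ), ∫ x, f x ∂(μ : Measure Ω) = ∫ ν, (∫ x, f x ∂(ν : Measure Ω)) ∂p) :
    (p.bind fun ν => (ν : Measure Ω)) = μ := by
  have : IsProbabilityMeasure (p.bind fun ν => (ν : Measure Ω)) :=
    (bary (⟨p, inferInstance⟩ : ProbabilityMeasure (ProbabilityMeasure Ω))).2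
  refine ext_of_forall_integral_eq_of_IsFiniteMeasure fun f => ?_
  have := integral_bind_toMeasure p f.toContinuousMap
  exact this.trans (h f.toContinuousMap).symm

end Borel

/-! ### Invariant σ-algebra and a mean ergodic theorem without amenability -/

section InvariantSets

variable {Γ A : Type*} [Group Γ] [MeasurableSpace A]

theorem measurable_shift (g : Γ) : Measurable (shift g : (Γ → A) → Γ → A) :=
  measurable_pi_iff.2 fun _ => measurable_pi_apply _

theorem shift_shift {A : Type*} (g h : Γ) (x : Γ → A) : shift g (shift h x) = shift (g * h) x := by
  funext k
  simp [shift, mul_assoc]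

/-- The σ-algebra of shift-invariant measurable sets. -/
@[reducible]
def invariantSets (Γ A : Type*) [Group Γ] [MeasurableSpace A] : MeasurableSpace (Γ → A) where
  MeasurableSet' E := MeasurableSet E ∧ ∀ g : Γ, shift g ⁻¹' E = E
  measurableSet_empty := ⟨MeasurableSet.empty, fun _ => rfl⟩
  measurableSet_compl E hE := ⟨hE.1.compl, fun g => by rw [Set.preimage_compl, hE.2 g]⟩
  measurableSet_iUnion f hf := ⟨MeasurableSet.iUnion fun i => (hf i).1, fun g => by
    rw [Set.preimage_iUnion]
    exact Set.iUnion_congr fun i => (hf i).2 g⟩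

theorem invariantSets_le : invariantSets Γ A ≤ MeasurableSpace.pi := fun _ hE => hE.1

theorem measurable_invariantSets {β : Type*} [MeasurableSpace β] {f : (Γ → A) → β}
    (hf : Measurable f) (h : ∀ (g : Γ) x, f (shift g x) = f x) :
    Measurable[invariantSets Γ A] f := fun W hW =>
  ⟨hf hW, fun g => by ext x; simp [h g x]⟩

theorem IsInvariant.measurePreserving {μ : ProbabilityMeasure (Γ → A)} (hμ : IsInvariant μ)
    (g : Γ) : MeasurePreserving (shift g) (μ : Measure (Γ → A)) μ :=
  ⟨measurable_shift g, hμ g⟩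

/-- The convex combinations of the translates of the indicator function of `B`. -/
def orbitAverages (B : Set (Γ → A)) : Set ((Γ → A) → ℝ) :=
  convexHull ℝ (Set.range fun g : Γ => (shift g ⁻¹' B).indicator fun _ => (1 : ℝ))

theorem orbitAverages_measurable {B : Set (Γ → A)} (hB : MeasurableSet B) {f : (Γ → A) → ℝ}
    (hf : f ∈ orbitAverages B) : Measurable f := by
  refine convexHull_min (t := {f | Measurable f}) ?_ ?_ hf
  · rintro _ ⟨g, rfl⟩
    exact measurable_const.indicator (measurable_shift g hB)
  · intro f hf f' hf' a b _ _ _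
    exact (Measurable.const_smul hf a).add (Measurable.const_smul hf' b)

omit [MeasurableSpace A] in
theorem orbitAverages_mem_Icc {B : Set (Γ → A)} {f : (Γ → A) → ℝ}
    (hf : f ∈ orbitAverages B) (x : Γ → A) : f x ∈ Set.Icc (0 : ℝ) 1 := by
  refine convexHull_min (t := {f | f x ∈ Set.Icc (0 : ℝ) 1}) ?_ ?_ hf
  · rintro _ ⟨g, rfl⟩
    by_cases h : x ∈ shift g ⁻¹' B <;> simp [h]
  · intro f hf f' hf' a b ha hb hab
    exact convex_Icc (0 : ℝ) 1 hf hf' ha hb hab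

/-- Translating `B` does not change its mass within an invariant set. The value is the same for
every orbit average and the identity holds for every invariant `ν`; this uniformity later lets one
kernel disintegrate many measures. -/
theorem orbitAverages_setIntegral {B : Set (Γ → A)} (hB : MeasurableSet B) {f : (Γ → A) → ℝ}
    (hf : f ∈ orbitAverages B) {ν : ProbabilityMeasure (Γ → A)} (hν : IsInvariant ν)
    {E : Set (Γ → A)} (hE : MeasurableSet[invariantSets Γ A] E) :
    ∫ x in E, f x ∂(ν : Measure (Γ → A)) = (ν : Measure (Γ → A)).real (E ∩ B) := by
  suffices h : Integrable f (ν : Measure (Γ → A)) ∧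
      ∫ x in E, f x ∂(ν : Measure (Γ → A)) = (ν : Measure (Γ → A)).real (E ∩ B) from h.2
  refine convexHull_min (t := {f | Integrable f (ν : Measure (Γ → A)) ∧
      ∫ x in E, f x ∂(ν : Measure (Γ → A)) = (ν : Measure (Γ → A)).real (E ∩ B)}) ?_ ?_ hf
  · rintro _ ⟨g, rfl⟩
    refine ⟨(integrable_const (1 : ℝ)).indicator (measurable_shift g hB), ?_⟩
    rw [integral_indicator (measurable_shift g hB), setIntegral_const, smul_eq_mul, mul_one,
      measureReal_restrict_apply (measurable_shift g hB), Set.inter_comm]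
    conv_lhs => rw [← hE.2 g, ← Set.preimage_inter]
    exact (hν.measurePreserving g).measureReal_preimage (hE.1.inter hB).nullMeasurableSet
  · rintro f ⟨hf, hf2⟩ f' ⟨hf', hf2'⟩ a b _ _ hab
    refine ⟨(hf.smul a).add (hf'.smul b), ?_⟩
    have h1 : ∫ x in E, (a • f + b • f') x ∂(ν : Measure (Γ → A)) =
        ∫ x in E, (a • f) x + (b • f') x ∂(ν : Measure (Γ → A)) := rfl
    rw [h1, integral_add (hf.smul a).integrableOn (hf'.smul b).integrableOn, Pi.smul_def, Pi.smul_def, integral_smul,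
      integral_smul, hf2, hf2', ← add_smul, hab, one_smul]

theorem eq_of_minimal_norm {F : Type*} [NormedAddCommGroup F] [InnerProductSpace ℝ F] {K : Set F}
    (hK : Convex ℝ K) {v w : F} (hv : v ∈ K) (h : ‖(0 : F) - v‖ = ⨅ w : K, ‖(0 : F) - w‖)
    (hw : w ∈ K) (hvw : ‖w‖ = ‖v‖) : w = v := by
  have h1 := (norm_eq_iInf_iff_real_inner_le_zero hK hv).1 h w hw
  rw [zero_sub, inner_neg_left, inner_sub_right, real_inner_self_eq_norm_sq] at h1
  have h2 := norm_sub_sq_real v w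
  have h3 : ‖v - w‖ ^ 2 ≤ 0 := by rw [h2, hvw]; linarith
  have h4 : ‖v - w‖ = 0 := by
    have := sq_nonneg ‖v - w‖
    exact pow_eq_zero_iff (two_ne_zero) |>.1 (le_antisymm h3 this)
  exact (sub_eq_zero.1 (norm_eq_zero.1 h4)).symm

variable [Countable Γ]

/-- The points at which `h` is constant along the whole orbit form a strictly invariant set of full
measure, by countability of `Γ`. Cutting `h` off outside it gives a strictly invariant version. -/
theorem aestronglyMeasurable_invariantSets {μ : Measure (Γ → A)} {h : (Γ → A) → ℝ}
    (hm : Measurable h) (hinv : ∀ g : Γ, ∀ᵐ x ∂μ, h (shift g x) = h x) :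
    AEStronglyMeasurable[invariantSets Γ A] h μ := by
  classical
  have hE : MeasurableSet {x : Γ → A | ∀ g : Γ, h (shift g x) = h x} := by
    simp only [Set.ofPred_forall]
    exact MeasurableSet.iInter fun g => measurableSet_eq_fun (hm.comp (measurable_shift g)) hm
  have hE' : ∀ (g : Γ) (x : Γ → A), (∀ k : Γ, h (shift k (shift g x)) = h (shift g x)) ↔
      ∀ k : Γ, h (shift k x) = h x := by
    intro g x
    simp only [shift_shift]
    constructor
    · intro H k
      have h1 := H (k * g⁻¹)
      have h2 := H g⁻¹
      simp only [inv_mul_cancel_right, inv_mul_cancel] at h1 h2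
      have h3 : shift (1 : Γ) x = x := by funext k; simp [shift]
      rw [h1, ← h2, h3]
    · intro H k
      rw [H, H]
  set E : Set (Γ → A) := {x : Γ → A | ∀ g : Γ, h (shift g x) = h x} with hEdef
  have hmem : ∀ x, x ∈ E ↔ ∀ g : Γ, h (shift g x) = h x := fun x => Iff.rfl
  refine ⟨E.indicator h, ?_, ?_⟩
  · refine Measurable.stronglyMeasurable ?_
    refine measurable_invariantSets (hm.indicator hE) fun g x => ?_
    by_cases hx : ∀ k : Γ, h (shift k x) = h x
    · rw [Set.indicator_of_mem ((hmem _).2 ((hE' g x).2 hx)),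
        Set.indicator_of_mem ((hmem _).2 hx), hx g]
    · rw [Set.indicator_of_notMem (fun H => hx ((hE' g x).1 ((hmem _).1 H))),
        Set.indicator_of_notMem (fun H => hx ((hmem _).1 H))]
  · filter_upwards [ae_all_iff.2 hinv] with x hx
    rw [Set.indicator_of_mem ((hmem _).2 hx)]

/-- The conditional expectation of an indicator function on the invariant σ-algebra is an almost
everywhere limit of convex combinations of translates. -/
theorem exists_orbitAverages_tendsto_condExp {μ : ProbabilityMeasure (Γ → A)} (hμ : IsInvariant μ)
    {B : Set (Γ → A)} (hB : MeasurableSet B) :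
    ∃ f : ℕ → (Γ → A) → ℝ, (∀ k, f k ∈ orbitAverages B) ∧
      ∀ᵐ x ∂(μ : Measure (Γ → A)), Tendsto (fun k => f k x) atTop
        (𝓝 (((μ : Measure (Γ → A))[B.indicator (fun _ => (1 : ℝ)) | invariantSets Γ A]) x)) := by
  let L : Γ → Lp ℝ 2 (μ : Measure (Γ → A)) := fun g =>
    indicatorConstLp 2 (measurable_shift g hB) (measure_ne_top _ _) (1 : ℝ)
  let U : Γ → Lp ℝ 2 (μ : Measure (Γ → A)) →ₗᵢ[ℝ] Lp ℝ 2 (μ : Measure (Γ → A)) := fun g =>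
    Lp.compMeasurePreservingₗᵢ ℝ (shift g) (hμ.measurePreserving g)
  have hUL : ∀ g g' : Γ, U g (L g') = L (g' * g) := by
    intro g g'
    have h1 : U g (L g') = indicatorConstLp 2
        (measurable_shift g (measurable_shift g' hB)) (measure_ne_top _ _) (1 : ℝ) := by
      exact Lp.indicatorConstLp_compMeasurePreserving (measurable_shift g' hB) _ _
        (hμ.measurePreserving g)
    rw [h1]
    have h2 : shift g ⁻¹' (shift g' ⁻¹' B) = shift (g' * g) ⁻¹' B := by
      ext x
      simp [shift_shift]
    simp only [L, h2]
  let K : Set (Lp ℝ 2 (μ : Measure (Γ → A))) := closure (convexHull ℝ (Set.range L))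
  have hKc : Convex ℝ K := (convex_convexHull ℝ _).closure
  have hUK : ∀ g, ∀ v ∈ K, U g v ∈ K := by
    intro g v hv
    refine map_mem_closure (U g).continuous hv fun w hw => ?_
    have h1 : (U g).toLinearMap w ∈ (U g).toLinearMap '' convexHull ℝ (Set.range L) := ⟨w, hw, rfl⟩
    rw [LinearMap.image_convexHull] at h1
    refine convexHull_mono ?_ h1
    rintro _ ⟨_, ⟨g', rfl⟩, rfl⟩
    exact ⟨g' * g, (hUL g g').symm⟩
  -- The element of least norm in the closed convex hull of the orbit. The Koopman isometries
  -- preserve the hull and the norm, so uniqueness makes it invariant.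
  obtain ⟨h, hhK, hh⟩ := exists_norm_eq_iInf_of_complete_convex (K := K)
    ⟨L 1, subset_closure (subset_convexHull ℝ _ ⟨1, rfl⟩)⟩ isClosed_closure.isComplete hKc 0
  have hinv : ∀ g : Γ, ∀ᵐ x ∂(μ : Measure (Γ → A)), h (shift g x) = h x := by
    intro g
    have h1 : U g h = h := eq_of_minimal_norm hKc hhK hh (hUK g h hhK) ((U g).norm_map h)
    have h2 := Lp.coeFn_compMeasurePreserving h (hμ.measurePreserving g)
    have h3 : Lp.compMeasurePreserving (shift g) (hμ.measurePreserving g) h = h := h1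
    rw [h3] at h2
    filter_upwards [h2] with x hx
    exact hx.symm
  have hmeas : AEStronglyMeasurable[invariantSets Γ A] h (μ : Measure (Γ → A)) :=
    aestronglyMeasurable_invariantSets (Lp.stronglyMeasurable h).measurable hinv
  obtain ⟨v, hv, hvh⟩ := mem_closure_iff_seq_limit.1 hhK
  -- Orbit averages are kept as honest functions rather than classes modulo `μ`, since they are
  -- later evaluated almost everywhere for other measures.
  have hrep : ∀ w ∈ convexHull ℝ (Set.range L), ∃ f ∈ orbitAverages B, w =ᵐ[(μ : Measure (Γ → A))] f := by
    intro w hw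
    refine convexHull_min
      (t := {w : Lp ℝ 2 (μ : Measure (Γ → A)) | ∃ f ∈ orbitAverages B, w =ᵐ[(μ : Measure (Γ → A))] f}) ?_ ?_ hw
    · rintro _ ⟨g, rfl⟩
      exact ⟨_, subset_convexHull ℝ _ ⟨g, rfl⟩, indicatorConstLp_coeFn⟩
    · rintro w ⟨f, hf, hwf⟩ w' ⟨f', hf', hwf'⟩ a b ha hb hab
      refine ⟨a • f + b • f', convex_convexHull ℝ _ hf hf' ha hb hab, ?_⟩
      filter_upwards [hwf, hwf', Lp.coeFn_add (a • w) (b • w'), Lp.coeFn_smul a w,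
        Lp.coeFn_smul b w'] with x h1 h2 h3 h4 h5
      rw [h3, Pi.add_apply, h4, h5]
      simp [h1, h2]
  choose f hf hvf using fun k => hrep (v k) (hv k)
  obtain ⟨ns, -, hns⟩ := (tendstoInMeasure_of_tendsto_Lp hvh).exists_seq_tendsto_ae
  have hlim : ∀ᵐ x ∂(μ : Measure (Γ → A)), Tendsto (fun k => f (ns k) x) atTop (𝓝 (h x)) := by
    filter_upwards [hns, ae_all_iff.2 hvf] with x hx1 hx2
    simpa only [hx2] using hx1
  have hcond : h =ᵐ[(μ : Measure (Γ → A))]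
      (μ : Measure (Γ → A))[B.indicator (fun _ => (1 : ℝ)) | invariantSets Γ A] := by
    have hint : Integrable h (μ : Measure (Γ → A)) :=
      (Lp.memLp h).integrable (by norm_num)
    refine ae_eq_condExp_of_forall_setIntegral_eq invariantSets_le
      ((integrable_const (1 : ℝ)).indicator hB) (fun s _ _ => hint.integrableOn) ?_ hmeas
    intro E hE _
    rw [integral_indicator hB, setIntegral_const, smul_eq_mul, mul_one,
      measureReal_restrict_apply hB, Set.inter_comm]
    have h1 : Tendsto (fun k => ∫ x in E, f (ns k) x ∂(μ : Measure (Γ → A))) atTop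
        (𝓝 (∫ x in E, h x ∂(μ : Measure (Γ → A)))) := by
      refine tendsto_integral_of_dominated_convergence (fun _ => (1 : ℝ))
        (fun k => (orbitAverages_measurable hB (hf _)).aestronglyMeasurable)
        (integrable_const _) (fun k => Eventually.of_forall fun x => ?_) (ae_restrict_of_ae hlim)
      have := orbitAverages_mem_Icc (hf (ns k)) x
      rw [Real.norm_eq_abs, abs_of_nonneg this.1]
      exact this.2
    simp only [orbitAverages_setIntegral hB (hf _) hμ hE] at h1
    exact tendsto_nhds_unique h1 tendsto_const_nhds
  refine ⟨fun k => f (ns k), fun k => hf _, ?_⟩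
  filter_upwards [hlim, hcond] with x hx1 hx2
  rwa [← hx2]

end InvariantSets

/-! ### A countable π-system determining measures -/

section CountablePiSystem

variable {Ω : Type*} [MeasurableSpace Ω]

/-- The finite intersections of a sequence of sets that generates the σ-algebra. -/
def basicSet (Ω : Type*) [MeasurableSpace Ω] [MeasurableSpace.CountablyGenerated Ω]
    (F : Finset ℕ) : Set Ω :=
  ⋂ n ∈ F, MeasurableSpace.natGeneratingSequence Ω n

variable [MeasurableSpace.CountablyGenerated Ω]

theorem measurableSet_basicSet (F : Finset ℕ) : MeasurableSet (basicSet Ω F) :=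
  Finset.measurableSet_biInter _ fun n _ => MeasurableSpace.measurableSet_natGeneratingSequence n

theorem isPiSystem_basicSet : IsPiSystem (Set.range (basicSet Ω)) := by
  classical
  rintro _ ⟨F, rfl⟩ _ ⟨F', rfl⟩ _
  refine ⟨F ∪ F', ?_⟩
  simp only [basicSet, Finset.mem_union, Set.iInter_or, Set.iInter_inter_distrib]

theorem generateFrom_basicSet :
    (inferInstance : MeasurableSpace Ω) = MeasurableSpace.generateFrom (Set.range (basicSet Ω)) := by
  apply le_antisymm
  · conv_lhs => rw [← MeasurableSpace.generateFrom_natGeneratingSequence Ω]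
    refine MeasurableSpace.generateFrom_mono ?_
    rintro _ ⟨n, rfl⟩
    exact ⟨{n}, by simp [basicSet]⟩
  · refine MeasurableSpace.generateFrom_le ?_
    rintro _ ⟨F, rfl⟩
    exact measurableSet_basicSet F

theorem ext_of_basicSet {μ ν : Measure Ω} [IsFiniteMeasure μ]
    (h : ∀ F, μ (basicSet Ω F) = ν (basicSet Ω F)) : μ = ν := by
  refine ext_of_generate_finite _ generateFrom_basicSet isPiSystem_basicSet ?_ ?_
  · rintro _ ⟨F, rfl⟩
    exact h F
  · simpa [basicSet] using h ∅

theorem ext_of_basicSet_real {μ ν : Measure Ω} [IsFiniteMeasure μ] [IsFiniteMeasure ν]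
    (h : ∀ F, μ.real (basicSet Ω F) = ν.real (basicSet Ω F)) : μ = ν :=
  ext_of_basicSet fun F => (measureReal_eq_measureReal_iff).1 (h F)

end CountablePiSystem

theorem measurable_apply_of_measurable {α Ω : Type*} [MeasurableSpace Ω] {m : MeasurableSpace α}
    {κ : α → ProbabilityMeasure Ω} (hκ : Measurable[m] κ) {B : Set Ω} (hB : MeasurableSet B) :
    Measurable[m] fun x => (κ x : Measure Ω) B :=
  (measurable_probabilityMeasure_apply hB).comp hκ

/-! ### Ergodic decomposition for shifts of countable groups -/

section ErgodicDecomposition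

variable {Γ A : Type*} [Group Γ] [Countable Γ] [MeasurableSpace A] [StandardBorelSpace A]

/-- If, `ν`-almost everywhere, translates of the basic sets average to the values of `κ`, then `κ`
disintegrates `ν` over the invariant σ-algebra. -/
theorem IsInvariant.restrict_bind_eq {κ : (Γ → A) → ProbabilityMeasure (Γ → A)}
    (hκ : Measurable κ) {f : Finset ℕ → ℕ → (Γ → A) → ℝ}
    (hf : ∀ F k, f F k ∈ orbitAverages (basicSet (Γ → A) F))
    {ν : ProbabilityMeasure (Γ → A)} (hν : IsInvariant ν)
    (hlim : ∀ᵐ x ∂(ν : Measure (Γ → A)), ∀ F, Tendsto (fun k => f F k x) atTop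
      (𝓝 ((κ x : Measure (Γ → A)).real (basicSet (Γ → A) F))))
    {E : Set (Γ → A)} (hE : MeasurableSet[invariantSets Γ A] E) :
    ((ν : Measure (Γ → A)).restrict E).bind (fun x => (κ x : Measure (Γ → A))) =
      (ν : Measure (Γ → A)).restrict E := by
  have hκ' : Measurable fun x => (κ x : Measure (Γ → A)) := measurable_toMeasure.comp hκ
  refine (ext_of_basicSet fun F => ?_).symm
  have hB := measurableSet_basicSet (Ω := Γ → A) F
  have hmeas : Measurable fun x => (κ x : Measure (Γ → A)).real (basicSet (Γ → A) F) :=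
    ((Measure.measurable_coe hB).comp hκ').ennreal_toReal
  rw [Measure.bind_apply hB hκ'.aemeasurable, Measure.restrict_apply hB, Set.inter_comm]
  -- Every term of this sequence equals `ν(E ∩ B)`, so the limit does too. Only invariance of `ν`
  -- and the almost everywhere convergence are used, not the measure for which `κ` was built.
  have h1 : Tendsto (fun k => ∫ x in E, f F k x ∂(ν : Measure (Γ → A))) atTop
      (𝓝 (∫ x in E, (κ x : Measure (Γ → A)).real (basicSet (Γ → A) F) ∂(ν : Measure (Γ → A)))) := by
    refine tendsto_integral_of_dominated_convergence (fun _ => (1 : ℝ))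
      (fun k => (orbitAverages_measurable hB (hf F k)).aestronglyMeasurable)
      (integrable_const _) (fun k => Eventually.of_forall fun x => ?_)
      (ae_restrict_of_ae (hlim.mono fun x hx => hx F))
    have := orbitAverages_mem_Icc (hf F k) x
    rw [Real.norm_eq_abs, abs_of_nonneg this.1]
    exact this.2
  simp only [orbitAverages_setIntegral hB (hf F _) hν hE] at h1
  have h2 := tendsto_nhds_unique h1 tendsto_const_nhds
  rw [integral_eq_lintegral_of_nonneg_ae (Eventually.of_forall fun _ => measureReal_nonneg)
    hmeas.aestronglyMeasurable] at h2
  have h3 : ∀ x, ENNReal.ofReal ((κ x : Measure (Γ → A)).real (basicSet (Γ → A) F)) =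
      (κ x : Measure (Γ → A)) (basicSet (Γ → A) F) := fun x => ofReal_measureReal
  simp only [h3] at h2
  rw [measureReal_def, ENNReal.toReal_eq_toReal_iff' ?_ (measure_ne_top _ _)] at h2
  · exact h2.symm
  · refine ne_top_of_le_ne_top (b := ∫⁻ x in E, 1 ∂(ν : Measure (Γ → A))) ?_
      (lintegral_mono fun x => prob_le_one)
    simp

/-- The kernel that disintegrates an ergodic measure over the invariant σ-algebra is constant. -/
theorem IsErgodic.ae_eq_of_restrict_bind_eq {κ : (Γ → A) → ProbabilityMeasure (Γ → A)}
    (hκ : Measurable[invariantSets Γ A] κ) {ν : ProbabilityMeasure (Γ → A)} (hν : IsErgodic ν)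
    (h : ∀ E, MeasurableSet[invariantSets Γ A] E →
      ((ν : Measure (Γ → A)).restrict E).bind (fun x => (κ x : Measure (Γ → A))) =
        (ν : Measure (Γ → A)).restrict E) :
    ∀ᵐ x ∂(ν : Measure (Γ → A)), κ x = ν := by
  have hκ' : Measurable fun x => (κ x : Measure (Γ → A)) :=
    measurable_toMeasure.comp (hκ.mono invariantSets_le le_rfl)
  have hF : ∀ᵐ x ∂(ν : Measure (Γ → A)), ∀ F : Finset ℕ,
      (κ x : Measure (Γ → A)) (basicSet (Γ → A) F) = (ν : Measure (Γ → A)) (basicSet (Γ → A) F) := by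
    refine ae_all_iff.2 fun F => ?_
    have hB := measurableSet_basicSet (Ω := Γ → A) F
    refine ae_eq_of_ae_eq_trim (hm := invariantSets_le) ?_
    refine ae_eq_of_forall_setLIntegral_eq_of_sigmaFinite
      (measurable_apply_of_measurable hκ hB) measurable_const fun E hE _ => ?_
    rw [setLIntegral_trim invariantSets_le (measurable_apply_of_measurable hκ hB) hE,
      setLIntegral_trim invariantSets_le measurable_const hE, setLIntegral_const,
      ← Measure.bind_apply hB hκ'.aemeasurable, h E hE,
      Measure.restrict_apply hB]
    rcases hν.2 E hE.1 hE.2 with h0 | h1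
    · rw [h0, mul_zero]
      exact measure_mono_null Set.inter_subset_right h0
    · rw [h1, mul_one]
      have h2 : (ν : Measure (Γ → A)) Eᶜ = 0 := (prob_compl_eq_zero_iff hE.1).2 h1
      exact measure_inter_conull h2
  filter_upwards [hF] with x hx
  exact ProbabilityMeasure.toMeasure_injective (ext_of_basicSet hx)

/-- **Ergodic decomposition** for a shift over a countable group: a measurable map `κ` to the space
of measures and a set `D` of full measure, such that `κ x` is ergodic for `x ∈ D`, and such that `κ`
disintegrates every invariant measure carried by `D`. -/
theorem IsInvariant.exists_ergodic_disintegration {μ : ProbabilityMeasure (Γ → A)}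
    (hμ : IsInvariant μ) :
    ∃ (κ : (Γ → A) → ProbabilityMeasure (Γ → A)) (D : Set (Γ → A)), Measurable κ ∧
      MeasurableSet D ∧ (μ : Measure (Γ → A)) Dᶜ = 0 ∧ (∀ x ∈ D, IsErgodic (κ x)) ∧
      (∀ ν : ProbabilityMeasure (Γ → A), IsInvariant ν → (ν : Measure (Γ → A)) Dᶜ = 0 →
        (ν : Measure (Γ → A)).bind (fun x => (κ x : Measure (Γ → A))) = ν) ∧
      (∀ ν : ProbabilityMeasure (Γ → A), IsErgodic ν → (ν : Measure (Γ → A)) Dᶜ = 0 →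
        ∀ᵐ x ∂(ν : Measure (Γ → A)), κ x = ν) := by
  have hI : invariantSets Γ A ≤ MeasurableSpace.pi := invariantSets_le
  let κ : (Γ → A) → ProbabilityMeasure (Γ → A) := fun x =>
    ⟨ProbabilityTheory.condExpKernel (μ : Measure (Γ → A)) (invariantSets Γ A) x, inferInstance⟩
  have hκI : Measurable[invariantSets Γ A] κ :=
    Measurable.subtype_mk (ProbabilityTheory.condExpKernel (μ : Measure (Γ → A)) (invariantSets Γ A)).measurable
  have hκ : Measurable κ := hκI.mono hI le_rfl
  have hκ' : Measurable fun x => (κ x : Measure (Γ → A)) := measurable_toMeasure.comp hκ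
  choose f hf hflim using fun F : Finset ℕ =>
    exists_orbitAverages_tendsto_condExp hμ (measurableSet_basicSet (Ω := Γ → A) F)
  let Lim : (Γ → A) → Prop := fun x => ∀ F, Tendsto (fun k => f F k x) atTop
    (𝓝 ((κ x : Measure (Γ → A)).real (basicSet (Γ → A) F)))
  have hlim : ∀ᵐ x ∂(μ : Measure (Γ → A)), Lim x := by
    refine ae_all_iff.2 fun F => ?_
    filter_upwards [hflim F, ProbabilityTheory.condExpKernel_ae_eq_condExp (μ := (μ : Measure (Γ → A)))
      hI (measurableSet_basicSet (Ω := Γ → A) F)] with x hx1 hx2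
    rw [← hx2] at hx1
    exact hx1
  have hbind : ∀ E, MeasurableSet[invariantSets Γ A] E →
      ((μ : Measure (Γ → A)).restrict E).bind (fun x => (κ x : Measure (Γ → A))) =
        (μ : Measure (Γ → A)).restrict E := fun E hE => hμ.restrict_bind_eq hκ hf hlim hE
  have hbind' : (μ : Measure (Γ → A)).bind (fun x => (κ x : Measure (Γ → A))) = μ := by
    simpa using hbind Set.univ MeasurableSet.univ
  -- two functions on the invariant σ-algebra with the same integrals agree
  have haeeq : ∀ u v : (Γ → A) → ℝ≥0∞, Measurable[invariantSets Γ A] u → Measurable[invariantSets Γ A] v →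
      (∀ E, MeasurableSet[invariantSets Γ A] E → ∫⁻ x in E, u x ∂(μ : Measure (Γ → A)) =
        ∫⁻ x in E, v x ∂(μ : Measure (Γ → A))) → ∀ᵐ x ∂(μ : Measure (Γ → A)), u x = v x := by
    intro u v hu hv huv
    refine ae_eq_of_ae_eq_trim (hm := hI) ?_
    refine ae_eq_of_forall_setLIntegral_eq_of_sigmaFinite hu hv fun E hE _ => ?_
    rw [setLIntegral_trim hI hu hE, setLIntegral_trim hI hv hE, huv E hE]
  have hinv : ∀ᵐ x ∂(μ : Measure (Γ → A)), IsInvariant (κ x) := by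
    have h1 : ∀ᵐ x ∂(μ : Measure (Γ → A)), ∀ (g : Γ) (F : Finset ℕ),
        (κ x : Measure (Γ → A)) (shift g ⁻¹' basicSet (Γ → A) F) =
          (κ x : Measure (Γ → A)) (basicSet (Γ → A) F) := by
      refine ae_all_iff.2 fun g => ae_all_iff.2 fun F => ?_
      have hB := measurableSet_basicSet (Ω := Γ → A) F
      have hB' := measurable_shift g hB
      refine haeeq _ _ (measurable_apply_of_measurable hκI hB')
        (measurable_apply_of_measurable hκI hB) fun E hE => ?_
      rw [← Measure.bind_apply hB hκ'.aemeasurable, ← Measure.bind_apply hB' hκ'.aemeasurable,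
        hbind E hE, Measure.restrict_apply hB, Measure.restrict_apply hB']
      conv_lhs => rw [← hE.2 g, ← Set.preimage_inter]
      exact (hμ.measurePreserving g).measure_preimage (hB.inter hE.1).nullMeasurableSet
    filter_upwards [h1] with x hx g
    refine (ext_of_basicSet fun F => ?_).symm
    rw [Measure.map_apply (measurable_shift g) (measurableSet_basicSet F), hx g F]
  have hconst : ∀ᵐ x ∂(μ : Measure (Γ → A)), ∀ᵐ y ∂(κ x : Measure (Γ → A)), κ y = κ x := by
    have h1 : ∀ (F : Finset ℕ), ∀ᵐ x ∂(μ : Measure (Γ → A)), ∀ᵐ y ∂(κ x : Measure (Γ → A)),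
        (κ y : Measure (Γ → A)).real (basicSet (Γ → A) F) =
          (κ x : Measure (Γ → A)).real (basicSet (Γ → A) F) := by
      intro F
      have hB := measurableSet_basicSet (Ω := Γ → A) F
      let r : (Γ → A) → ℝ := fun x => (κ x : Measure (Γ → A)).real (basicSet (Γ → A) F)
      have hr : Measurable[invariantSets Γ A] r := (measurable_apply_of_measurable hκI hB).ennreal_toReal
      -- The sublevel sets of `r` are invariant, so `κ x` gives them mass 0 or 1 according to
      -- whether they contain `x`; rational levels then force `r` to be `κ x`-almost surely equal to
      -- `r x`.
      have h2 : ∀ᵐ x ∂(μ : Measure (Γ → A)), ∀ q : ℚ,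
          (κ x : Measure (Γ → A)) (r ⁻¹' Set.Iio (q : ℝ)) =
            (r ⁻¹' Set.Iio (q : ℝ)).indicator (fun _ => 1) x := by
        refine ae_all_iff.2 fun q => ?_
        have hJ : MeasurableSet[invariantSets Γ A] (r ⁻¹' Set.Iio (q : ℝ)) := hr measurableSet_Iio
        refine haeeq _ _ (measurable_apply_of_measurable hκI hJ.1)
          (measurable_const.indicator hJ) fun E hE => ?_
        rw [← Measure.bind_apply hJ.1 hκ'.aemeasurable, hbind E hE, lintegral_indicator_const hJ.1,
          one_mul]
      filter_upwards [h2] with x hx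
      have h3 : ∀ᵐ y ∂(κ x : Measure (Γ → A)), ∀ q : ℚ, (r y < q ↔ r x < q) := by
        refine ae_all_iff.2 fun q => ?_
        have hJ : MeasurableSet (r ⁻¹' Set.Iio (q : ℝ)) := hI _ (hr measurableSet_Iio)
        by_cases hxq : r x < q
        · have h4 : (κ x : Measure (Γ → A)) (r ⁻¹' Set.Iio (q : ℝ)) = 1 := by
            rw [hx q, Set.indicator_of_mem (by exact hxq)]
          have h5 := (prob_compl_eq_zero_iff hJ).2 h4
          filter_upwards [compl_mem_ae_iff.2 h5] with y hy
          have : r y < q := by simpa using hy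
          exact iff_of_true this hxq
        · have h4 : (κ x : Measure (Γ → A)) (r ⁻¹' Set.Iio (q : ℝ)) = 0 := by
            rw [hx q, Set.indicator_of_notMem (by exact hxq)]
          filter_upwards [compl_mem_ae_iff.2 h4] with y hy
          have : ¬ r y < q := by simpa using hy
          exact iff_of_false this hxq
      filter_upwards [h3] with y hy
      rcases lt_trichotomy (r y) (r x) with h | h | h
      · obtain ⟨q, hq1, hq2⟩ := exists_rat_btwn h
        exact absurd ((hy q).1 hq1) (not_lt.2 hq2.le)
      · exact h
      · obtain ⟨q, hq1, hq2⟩ := exists_rat_btwn h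
        exact absurd ((hy q).2 hq1) (not_lt.2 hq2.le)
    filter_upwards [ae_all_iff.2 h1] with x hx
    filter_upwards [ae_all_iff.2 hx] with y hy
    exact ProbabilityMeasure.toMeasure_injective (ext_of_basicSet_real hy)
  have hlimκ : ∀ᵐ x ∂(μ : Measure (Γ → A)), ∀ᵐ y ∂(κ x : Measure (Γ → A)), Lim y := by
    refine Measure.ae_ae_of_ae_bind hκ'.aemeasurable ?_
    rwa [hbind']
  have herg : ∀ᵐ x ∂(μ : Measure (Γ → A)), IsErgodic (κ x) := by
    filter_upwards [hinv, hconst, hlimκ] with x hx1 hx2 hx3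
    refine ⟨hx1, fun E hE hEinv => ?_⟩
    -- Since `κ` is `κ x`-almost surely the constant `κ x`, the disintegration of `κ x` restricted
    -- to `E`, evaluated at `E`, reads `t * t = t` with `t = κ x E`.
    have h1 := hx1.restrict_bind_eq hκ hf hx3 (E := E) ⟨hE, hEinv⟩
    have h2 : (fun y => (κ y : Measure (Γ → A))) =ᵐ[(κ x : Measure (Γ → A)).restrict E]
        fun _ => (κ x : Measure (Γ → A)) :=
      ae_restrict_of_ae (hx2.mono fun y hy => congrArg (fun m : ProbabilityMeasure (Γ → A) => (m : Measure (Γ → A))) hy)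
    rw [Measure.bind_congr_right h2, Measure.bind_const, Measure.restrict_apply_univ] at h1
    have h3 := congrArg (fun m : Measure (Γ → A) => m E) h1
    simp only [Measure.smul_apply, smul_eq_mul, Measure.restrict_apply_self] at h3
    by_cases h0 : (κ x : Measure (Γ → A)) E = 0
    · exact Or.inl h0
    · exact Or.inr ((ENNReal.mul_eq_left h0 (measure_ne_top _ _)).1 h3)
  -- The set `D` is the complement of this measurable null set. It records convergence as well as
  -- ergodicity, so any invariant `ν` carried by `D` is disintegrated by the same `κ`.
  let N : Set (Γ → A) := toMeasurable (μ : Measure (Γ → A)) {x | ¬ (Lim x ∧ IsErgodic (κ x))}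
  have hN : (μ : Measure (Γ → A)) N = 0 := by
    rw [measure_toMeasurable]
    exact hlim.and herg
  have hND : ∀ x ∈ Nᶜ, Lim x ∧ IsErgodic (κ x) := by
    intro x hx
    by_contra h
    exact hx (subset_toMeasurable _ _ h)
  have hae : ∀ ν : ProbabilityMeasure (Γ → A), (ν : Measure (Γ → A)) Nᶜᶜ = 0 →
      ∀ᵐ x ∂(ν : Measure (Γ → A)), Lim x := fun ν hν => by
    filter_upwards [mem_ae_iff.2 hν] with x hx
    exact (hND x hx).1
  refine ⟨κ, Nᶜ, hκ, (measurableSet_toMeasurable _ _).compl, by rwa [compl_compl],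
    fun x hx => (hND x hx).2, fun ν hν hν0 => ?_, fun ν hν hν0 => ?_⟩
  · simpa using hν.restrict_bind_eq hκ hf (hae ν hν0) (E := Set.univ) MeasurableSet.univ
  · exact hν.ae_eq_of_restrict_bind_eq hκI fun E hE =>
      hν.1.restrict_bind_eq hκ hf (hae ν hν0) hE

end ErgodicDecomposition

/-! ### Calculus of exponential growth rates -/

section GrowthRate

variable {V : ℕ → Type*} [∀ n, Fintype (V n)]

/-- The sequence `exp (c |V n|)`. -/
def expCard (V : ℕ → Type*) [∀ n, Fintype (V n)] (c : ℝ) (n : ℕ) : ℝ≥0∞ :=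
  ENNReal.ofReal (Real.exp (c * Fintype.card (V n)))

theorem expCard_ne_top (c : ℝ) (n : ℕ) : expCard V c n ≠ ⊤ := ENNReal.ofReal_ne_top

theorem expCard_add (c d : ℝ) (n : ℕ) : expCard V (c + d) n = expCard V c n * expCard V d n := by
  rw [expCard, expCard, expCard, ← ENNReal.ofReal_mul (Real.exp_pos _).le, ← Real.exp_add, add_mul]

theorem expCard_eq_exp (c : ℝ) (n : ℕ) :
    expCard V c n = EReal.exp (((Fintype.card (V n) : ℝ) : EReal) * (c : EReal)) := by
  rw [← EReal.coe_mul, EReal.exp_coe, expCard, mul_comm]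

theorem eventually_le_expCard (hV : Tendsto (fun n => Fintype.card (V n)) atTop atTop) {c : ℝ}
    (hc : 0 < c) {C : ℝ≥0∞} (hC : C ≠ ⊤) : ∀ᶠ n in atTop, C ≤ expCard V c n := by
  have h1 : Tendsto (fun n => Real.exp (c * (Fintype.card (V n) : ℝ))) atTop atTop :=
    Real.tendsto_exp_atTop.comp ((tendsto_natCast_atTop_atTop.comp hV).const_mul_atTop hc)
  filter_upwards [h1.eventually_ge_atTop C.toReal] with n hn
  rw [← ENNReal.ofReal_toReal hC]
  exact ENNReal.ofReal_le_ofReal hn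

theorem eventually_lt_expCard_of_growthRate_lt
    (hV : Tendsto (fun n => Fintype.card (V n)) atTop atTop) {a : ℕ → ℝ≥0∞} {c : ℝ}
    (h : growthRate V a < c) : ∀ᶠ n in atTop, a n < expCard V c n := by
  filter_upwards [eventually_lt_of_limsup_lt h, hV.eventually_gt_atTop 0] with n hn hN
  have hN' : (0 : EReal) < ((Fintype.card (V n) : ℝ) : EReal) := by exact_mod_cast hN
  rw [EReal.div_lt_iff hN' (EReal.coe_ne_top _), mul_comm] at hn
  rw [expCard_eq_exp, ← ENNReal.log_lt_log_iff, EReal.log_exp]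
  exact hn

theorem frequently_expCard_lt_of_lt_growthRate
    (hV : Tendsto (fun n => Fintype.card (V n)) atTop atTop) {a : ℕ → ℝ≥0∞} {c : ℝ}
    (h : c < growthRate V a) : ∃ᶠ n in atTop, expCard V c n < a n := by
  refine ((frequently_lt_of_lt_limsup (by isBoundedDefault) h).and_eventually
    (hV.eventually_gt_atTop 0)).mono fun n hn => ?_
  have hN' : (0 : EReal) < ((Fintype.card (V n) : ℝ) : EReal) := by exact_mod_cast hn.2
  have h1 := hn.1
  rw [EReal.lt_div_iff hN' (EReal.coe_ne_top _), mul_comm] at h1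
  rw [expCard_eq_exp, ← ENNReal.log_lt_log_iff, EReal.log_exp]
  exact h1

/-- For every `z > c` the constant is absorbed by `exp ((z - c)|V n|)`, because `|V n|` tends to
infinity. -/
theorem growthRate_le_of_eventually_le
    (hV : Tendsto (fun n => Fintype.card (V n)) atTop atTop) {a : ℕ → ℝ≥0∞} {c : ℝ} {C : ℝ≥0∞}
    (hC : C ≠ ⊤) (h : ∀ᶠ n in atTop, a n ≤ C * expCard V c n) : growthRate V a ≤ c := by
  refine EReal.le_of_forall_lt_iff_le.1 fun z hz => ?_
  have hz' : 0 < z - c := sub_pos.2 (EReal.coe_lt_coe_iff.1 hz)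
  refine limsup_le_of_le (by isBoundedDefault) ?_
  filter_upwards [h, eventually_le_expCard hV hz' hC, hV.eventually_gt_atTop 0] with n h1 h2 hN
  have hN' : (0 : EReal) < ((Fintype.card (V n) : ℝ) : EReal) := by exact_mod_cast hN
  rw [EReal.div_le_iff_le_mul hN' (EReal.coe_ne_top _)]
  have h3 : a n ≤ expCard V z n := by
    refine h1.trans ?_
    rw [show z = (z - c) + c by ring, expCard_add]
    gcongr
  rw [expCard_eq_exp, ← ENNReal.log_le_log_iff, EReal.log_exp] at h3
  exact h3

theorem growthRate_mono {a b : ℕ → ℝ≥0∞} (h : ∀ n, a n ≤ b n) : growthRate V a ≤ growthRate V b :=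
  limsup_le_limsup (Eventually.of_forall fun n => by
    have h1 := ENNReal.log_le_log (h n)
    exact EReal.div_le_div_right_of_nonneg (by exact_mod_cast Nat.zero_le _) h1)

theorem growthRate_le_add (hV : Tendsto (fun n => Fintype.card (V n)) atTop atTop)
    {a b : ℕ → ℝ≥0∞} {c : ℝ} {C : ℝ≥0∞} (hC : C ≠ ⊤)
    (h : ∀ᶠ n in atTop, a n ≤ C * expCard V c n * b n) :
    growthRate V a ≤ c + growthRate V b := by
  refine EReal.le_of_forall_lt_iff_le.1 fun z hz => ?_
  have hz' : growthRate V b < ((z - c : ℝ) : EReal) := by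
    rw [EReal.coe_sub]
    rw [add_comm] at hz
    exact (EReal.lt_sub_iff_add_lt (Or.inl (EReal.coe_ne_bot _)) (Or.inl (EReal.coe_ne_top _))).2 hz
  refine growthRate_le_of_eventually_le hV hC ?_
  filter_upwards [h, eventually_lt_expCard_of_growthRate_lt hV hz'] with n h1 h2
  refine h1.trans ?_
  rw [show z = c + (z - c) by ring, expCard_add, mul_assoc]
  gcongr

theorem growthRate_add_lt (hV : Tendsto (fun n => Fintype.card (V n)) atTop atTop)
    {a b d : ℕ → ℝ≥0∞} (hd : ∀ n, d n ≤ a n + b n) {c : EReal} (ha : growthRate V a < c)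
    (hb : growthRate V b < c) : growthRate V d < c := by
  obtain ⟨z, hz1, hz2⟩ := EReal.lt_iff_exists_real_btwn.1 (max_lt ha hb)
  refine lt_of_le_of_lt (growthRate_le_of_eventually_le hV (C := 2) (by norm_num) ?_) hz2
  filter_upwards [eventually_lt_expCard_of_growthRate_lt hV ((le_max_left _ _).trans_lt hz1),
    eventually_lt_expCard_of_growthRate_lt hV ((le_max_right _ _).trans_lt hz1)] with n h1 h2
  refine (hd n).trans ?_
  rw [two_mul]
  exact add_le_add h1.le h2.le

theorem growthRate_zero (hV : Tendsto (fun n => Fintype.card (V n)) atTop atTop) :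
    growthRate V (fun _ => 0) = ⊥ := by
  refine (EReal.eq_bot_iff_forall_lt _).2 fun y => ?_
  have h : growthRate V (fun _ => 0) ≤ ((y - 1 : ℝ) : EReal) :=
    growthRate_le_of_eventually_le hV (C := 0) (by simp) (Eventually.of_forall fun n => zero_le)
  exact h.trans_lt (EReal.coe_lt_coe_iff.2 (by linarith))

theorem growthRate_one : growthRate V (fun _ => 1) = 0 := by
  simp [growthRate]

end GrowthRate

/-! ### Local values of set functions and limits along open neighbourhoods -/

section OpenNhds

variable {M : Type*} [TopologicalSpace M]

theorem eventually_openNhds {K U₀ : Set M} (hU₀ : IsOpen U₀) (hK : K ⊆ U₀) :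
    ∀ᶠ U in openNhds K, IsOpen U ∧ K ⊆ U ∧ U ⊆ U₀ :=
  mem_iInf_of_mem U₀ (mem_iInf_of_mem ⟨hU₀, hK⟩ (mem_principal_self _))

instance openNhds_neBot (K : Set M) : (openNhds K).NeBot := by
  have : openNhds K = ⨅ U₀ : {U : Set M | IsOpen U ∧ K ⊆ U},
      𝓟 {U | IsOpen U ∧ K ⊆ U ∧ U ⊆ (U₀ : Set M)} := by
    rw [openNhds, iInf_subtype']
  rw [this]
  have : Nonempty {U : Set M | IsOpen U ∧ K ⊆ U} := ⟨⟨Set.univ, isOpen_univ, Set.subset_univ _⟩⟩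
  refine iInf_neBot_of_directed' ?_ fun U₀ => principal_neBot_iff.2
    ⟨U₀, U₀.2.1, U₀.2.2, subset_rfl⟩
  intro U₁ U₂
  refine ⟨⟨U₁ ∩ U₂, U₁.2.1.inter U₂.2.1, Set.subset_inter U₁.2.2 U₂.2.2⟩, ?_, ?_⟩
  · exact principal_mono.2 fun U hU => ⟨hU.1, hU.2.1, hU.2.2.trans Set.inter_subset_left⟩
  · exact principal_mono.2 fun U hU => ⟨hU.1, hU.2.1, hU.2.2.trans Set.inter_subset_right⟩

variable {G : Set M → EReal}

/-- The local value of a monotone set function. -/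
def localValue (G : Set M → EReal) (ν : M) : EReal := ⨅ O ∈ {O : Set M | IsOpen O ∧ ν ∈ O}, G O

theorem localValue_le {ν : M} {O : Set M} (hO : IsOpen O) (hν : ν ∈ O) : localValue G ν ≤ G O :=
  iInf₂_le (f := fun O (_ : O ∈ {O : Set M | IsOpen O ∧ ν ∈ O}) => G O) O ⟨hO, hν⟩

theorem exists_of_localValue_lt {ν : M} {c : EReal} (h : localValue G ν < c) :
    ∃ O, IsOpen O ∧ ν ∈ O ∧ G O < c := by
  simp only [localValue, iInf_lt_iff] at h
  obtain ⟨O, hO, h⟩ := h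
  exact ⟨O, hO.1, hO.2, h⟩

/-- An open set witnessing a small local value at `ν` is a witness for all of its points. -/
theorem upperSemicontinuous_localValue : UpperSemicontinuous (localValue G) := by
  intro ν c hc
  obtain ⟨O, hO, hν, h⟩ := exists_of_localValue_lt hc
  filter_upwards [hO.mem_nhds hν] with ν' hν'
  exact (localValue_le hO hν').trans_lt h

/-- For a monotone and maximum-subadditive set function, the values on the small neighbourhoods of
a compact set are controlled by the local values on the set. -/
theorem exists_open_lt_of_localValue_lt (hempty : G ∅ = ⊥)
    (hunion : ∀ U U' c, IsOpen U → IsOpen U' → G U < c → G U' < c → G (U ∪ U') < c)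
    {K : Set M} (hK : IsCompact K) {c : EReal} (hc : ⊥ < c) (h : ∀ ν ∈ K, localValue G ν < c) :
    ∃ U, IsOpen U ∧ K ⊆ U ∧ G U < c := by
  refine hK.induction_on (p := fun s => ∃ U, IsOpen U ∧ s ⊆ U ∧ G U < c) ?_ ?_ ?_ ?_
  · exact ⟨∅, isOpen_empty, subset_rfl, by rwa [hempty]⟩
  · rintro s t hst ⟨U, hU, htU, hG⟩
    exact ⟨U, hU, hst.trans htU, hG⟩
  · rintro s t ⟨U, hU, hsU, hG⟩ ⟨U', hU', htU', hG'⟩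
    exact ⟨U ∪ U', hU.union hU', Set.union_subset_union hsU htU', hunion U U' c hU hU' hG hG'⟩
  · intro ν hν
    obtain ⟨O, hO, hνO, hG⟩ := exists_of_localValue_lt (h ν hν)
    exact ⟨O, mem_nhdsWithin_of_mem_nhds (hO.mem_nhds hνO), O, hO, subset_rfl, hG⟩

/-- The maximum of the local values on a compact set is attained, and it is the limit of the values
on the open neighbourhoods of the set. -/
theorem exists_isGreatest_tendsto_openNhds (hmono : Monotone G) (hempty : G ∅ = ⊥)
    (hunion : ∀ U U' c, IsOpen U → IsOpen U' → G U < c → G U' < c → G (U ∪ U') < c)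
    {K : Set M} (hK : IsCompact K) (hne : K.Nonempty) :
    ∃ ν₀ ∈ K, (∀ ν ∈ K, localValue G ν ≤ localValue G ν₀) ∧
      Tendsto G (openNhds K) (𝓝 (localValue G ν₀)) := by
  obtain ⟨ν₀, hν₀, hmax⟩ := UpperSemicontinuousOn.exists_isMaxOn hne hK
    ((upperSemicontinuous_localValue (G := G)).upperSemicontinuousOn K)
  refine ⟨ν₀, hν₀, fun ν hν => hmax hν, ?_⟩
  refine tendsto_order.2 ⟨fun c hc => ?_, fun c hc => ?_⟩
  · filter_upwards [eventually_openNhds isOpen_univ (Set.subset_univ K)] with U hU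
    exact hc.trans_le (localValue_le hU.1 (hU.2.1 hν₀))
  -- Every local value on `K` is below `c`, so compactness gives one neighbourhood of `K` with value
  -- below `c`, and monotonicity passes this to all smaller ones.
  · obtain ⟨U₀, hU₀, hKU₀, hG⟩ := exists_open_lt_of_localValue_lt hempty hunion hK
      (bot_le.trans_lt hc) fun ν hν => (hmax hν).trans_lt hc
    filter_upwards [eventually_openNhds hU₀ hKU₀] with U hU
    exact (hmono hU.2.2).trans_lt hG

end OpenNhds

/-! ### Partition functions over a fixed map -/

section Finite

variable {Γ A V : Type*} [Fintype V] [Nonempty V] [MeasurableSpace A]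

theorem empirical_apply (σ : Γ → Equiv.Perm V) (x : V → A) {B : Set (Γ → A)}
    (hB : MeasurableSet B) :
    (empirical σ x : Measure (Γ → A)) B =
      ∑ v, (Fintype.card V : ℝ≥0∞)⁻¹ * B.indicator 1 (pullbackName σ x v) := by
  let _ : MeasurableSpace V := ⊤
  change ((PMF.uniformOfFintype V).map (pullbackName σ x)).toMeasure B = _
  rw [PMF.toMeasure_map_apply _ _ _ measurable_from_top hB, PMF.toMeasure_apply_fintype]
  refine Finset.sum_congr rfl fun v _ => ?_
  by_cases h : pullbackName σ x v ∈ B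
  · rw [Set.indicator_of_mem (by exact h), Set.indicator_of_mem h]
    simp
  · rw [Set.indicator_of_notMem (by exact h), Set.indicator_of_notMem h]
    simp

theorem totalEnergy_eq (w : (Γ → A) → ℝ) (hw : Measurable w) (σ : Γ → Equiv.Perm V) (x : V → A) :
    totalEnergy w σ x = Fintype.card V * ∫ y, w y ∂(empirical σ x : Measure (Γ → A)) := by
  let _ : MeasurableSpace V := ⊤
  have h1 : (empirical σ x : Measure (Γ → A)) =
      (PMF.uniformOfFintype V).toMeasure.map (pullbackName σ x) :=
    (PMF.toMeasure_map _ _ measurable_from_top).symm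
  have hN : (Fintype.card V : ℝ) ≠ 0 := Nat.cast_ne_zero.2 Fintype.card_ne_zero
  rw [h1, integral_map measurable_from_top.aemeasurable hw.aestronglyMeasurable,
    PMF.integral_eq_sum, Finset.mul_sum, totalEnergy]
  refine Finset.sum_congr rfl fun v _ => ?_
  simp

variable [Finite A]

/-- This turns the hypothesis on average empirical measures into one on barycenters of laws of
empirical measures. -/
theorem avgEmpirical_eq_bary (σ : Γ → Equiv.Perm V) (ζ : PMF (V → A)) :
    avgEmpirical σ ζ = bary ⟨(ζ.map (empirical σ)).toMeasure, inferInstance⟩ := by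
  let _ : MeasurableSpace (V → A) := ⊤
  refine ProbabilityMeasure.toMeasure_injective (Measure.ext fun B hB => ?_)
  change (ζ.bind fun x => (PMF.uniformOfFintype V).map (pullbackName σ x)).toMeasure B =
    ((ζ.map (empirical σ)).toMeasure.bind fun ν => (ν : Measure (Γ → A))) B
  rw [PMF.toMeasure_bind_apply _ _ _ hB, Measure.bind_apply hB measurable_toMeasure.aemeasurable,
    ← PMF.toMeasure_map _ _ measurable_from_top,
    lintegral_map (measurable_probabilityMeasure_apply hB) measurable_from_top,
    lintegral_countable']
  refine tsum_congr fun x => ?_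
  rw [PMF.toMeasure_apply_singleton _ _ (MeasurableSet.singleton x), mul_comm]
  rfl

/-- The partition function of the restricted Gibbs state. -/
def partitionFunction (w : (Γ → A) → ℝ) (σ : Γ → Equiv.Perm V)
    (U : Set (ProbabilityMeasure (Γ → A))) : ℝ≥0∞ :=
  ∑' x, gibbsWeight w σ U x

variable {w : (Γ → A) → ℝ} {σ : Γ → Equiv.Perm V} {U U' : Set (ProbabilityMeasure (Γ → A))}

omit [Finite A] in
theorem gibbsWeight_of_mem {x : V → A} (h : empirical σ x ∈ U) :
    gibbsWeight w σ U x = ENNReal.ofReal (Real.exp (-totalEnergy w σ x)) :=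
  if_pos h

omit [Finite A] in
theorem gibbsWeight_of_notMem {x : V → A} (h : empirical σ x ∉ U) : gibbsWeight w σ U x = 0 :=
  if_neg h

theorem partitionFunction_ne_top : partitionFunction w σ U ≠ ⊤ := gibbsWeight_tsum_ne_top w σ U

omit [Finite A] in
theorem gibbsWeight_mono (h : U ⊆ U') (x : V → A) : gibbsWeight w σ U x ≤ gibbsWeight w σ U' x := by
  by_cases hx : empirical σ x ∈ U
  · rw [gibbsWeight_of_mem hx, gibbsWeight_of_mem (h hx)]
  · rw [gibbsWeight_of_notMem hx]
    exact zero_le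

omit [Finite A] in
theorem partitionFunction_mono (h : U ⊆ U') :
    partitionFunction w σ U ≤ partitionFunction w σ U' :=
  ENNReal.tsum_le_tsum (gibbsWeight_mono h)

omit [Finite A] in
theorem partitionFunction_union_le :
    partitionFunction w σ (U ∪ U') ≤ partitionFunction w σ U + partitionFunction w σ U' := by
  rw [partitionFunction, partitionFunction, partitionFunction, ← ENNReal.tsum_add]
  refine ENNReal.tsum_le_tsum fun x => ?_
  by_cases hx : empirical σ x ∈ U
  · rw [gibbsWeight_of_mem hx, gibbsWeight_of_mem (Or.inl hx)]
    exact le_self_add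
  · by_cases hx' : empirical σ x ∈ U'
    · rw [gibbsWeight_of_mem hx', gibbsWeight_of_mem (Or.inr hx')]
      exact le_add_self
    · rw [gibbsWeight_of_notMem (fun h => h.elim hx hx')]
      exact zero_le

omit [Finite A] in
theorem partitionFunction_empty : partitionFunction w σ ∅ = 0 :=
  ENNReal.tsum_eq_zero.2 fun _ => gibbsWeight_of_notMem (Set.notMem_empty _)

omit [Finite A] in
theorem partitionFunction_eq_zero (h : ¬ (microstates σ U).Nonempty) :
    partitionFunction w σ U = 0 :=
  ENNReal.tsum_eq_zero.2 fun x => gibbsWeight_of_notMem fun hx => h ⟨x, hx⟩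

omit [Finite A] in
theorem partitionFunction_ne_zero (h : (microstates σ U).Nonempty) : partitionFunction w σ U ≠ 0 :=
  gibbsWeight_tsum_ne_zero w σ U h

theorem ncard_microstates :
    ((microstates σ U).ncard : ℝ≥0∞) = ∑' x : V → A, (microstates σ U).indicator 1 x := by
  classical
  have := Fintype.ofFinite A
  rw [tsum_fintype, Set.ncard_eq_toFinset_card', Finset.sum_indicator_eq_sum_filter]
  simp [Set.toFinset]

theorem gibbsState_apply (h : (microstates σ U).Nonempty) (x : V → A) :
    gibbsState w σ U h x = gibbsWeight w σ U x * (partitionFunction w σ U)⁻¹ :=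
  PMF.normalize_apply _ _ _

/-- The Gibbs state attains the pressure `log Z`. -/
theorem expGibbsPressure_eq : expGibbsPressure w σ U = partitionFunction w σ U := by
  classical
  have := Fintype.ofFinite A
  by_cases h : (microstates σ U).Nonempty
  · rw [expGibbsPressure, dif_pos h]
    set Z : ℝ := (partitionFunction w σ U).toReal with hZ
    have hZpos : 0 < Z := ENNReal.toReal_pos (partitionFunction_ne_zero h) partitionFunction_ne_top
    -- On the support `log ξ{x} = -Ũ(x) - log Z`, so the energy cancels and each term is `ξ{x} log
    -- Z`; off the support both sides vanish.
    have hterm : ∀ x, Real.negMulLog (gibbsState w σ U h x).toReal -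
        (gibbsState w σ U h x).toReal * totalEnergy w σ x =
        (gibbsState w σ U h x).toReal * Real.log Z := by
      intro x
      rw [gibbsState_apply, ENNReal.toReal_mul, ENNReal.toReal_inv, ← hZ]
      by_cases hx : empirical σ x ∈ U
      · rw [gibbsWeight_of_mem hx, ENNReal.toReal_ofReal (Real.exp_pos _).le, Real.negMulLog,
          Real.log_mul (Real.exp_pos _).ne' (inv_pos.2 hZpos).ne', Real.log_exp, Real.log_inv]
        ring
      · rw [gibbsWeight_of_notMem hx]
        simp
    have hsum : ∑ x, (gibbsState w σ U h x).toReal = 1 := by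
      rw [← ENNReal.toReal_sum fun x _ => PMF.apply_ne_top _ x, ← tsum_fintype (L := SummationFilter.unconditional _),
        PMF.tsum_coe,
        ENNReal.toReal_one]
    have hP : finPressure w σ (gibbsState w σ U h) = Real.log Z := by
      rw [finPressure, shannonEntropy, tsum_fintype, tsum_fintype, ← Finset.sum_sub_distrib,
        Finset.sum_congr rfl fun x _ => hterm x, ← Finset.sum_mul, hsum, one_mul]
    rw [hP, Real.exp_log hZpos, hZ, ENNReal.ofReal_toReal partitionFunction_ne_top]
  · rw [expGibbsPressure, dif_neg h, partitionFunction_eq_zero h]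

theorem partitionFunction_le (hw : Measurable w) {c : ℝ}
    (h : ∀ ν ∈ U, -c ≤ ∫ y, w y ∂(ν : Measure (Γ → A))) :
    partitionFunction w σ U ≤
      ENNReal.ofReal (Real.exp (c * Fintype.card V)) * ((microstates σ U).ncard : ℝ≥0∞) := by
  rw [ncard_microstates, ← ENNReal.tsum_mul_left]
  refine ENNReal.tsum_le_tsum fun x => ?_
  by_cases hx : empirical σ x ∈ U
  · rw [gibbsWeight_of_mem hx, Set.indicator_of_mem (by exact hx), Pi.one_apply, mul_one,
      totalEnergy_eq w hw]
    refine ENNReal.ofReal_le_ofReal (Real.exp_le_exp.2 ?_)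
    have := mul_le_mul_of_nonneg_left (h _ hx) (Nat.cast_nonneg (α := ℝ) (Fintype.card V))
    linarith
  · rw [gibbsWeight_of_notMem hx]
    exact zero_le

theorem ncard_microstates_le (hw : Measurable w) {c : ℝ}
    (h : ∀ ν ∈ U, ∫ y, w y ∂(ν : Measure (Γ → A)) ≤ c) :
    ((microstates σ U).ncard : ℝ≥0∞) ≤
      ENNReal.ofReal (Real.exp (c * Fintype.card V)) * partitionFunction w σ U := by
  rw [ncard_microstates, partitionFunction, ← ENNReal.tsum_mul_left]
  refine ENNReal.tsum_le_tsum fun x => ?_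
  by_cases hx : empirical σ x ∈ U
  · rw [gibbsWeight_of_mem hx, Set.indicator_of_mem (by exact hx), Pi.one_apply,
      totalEnergy_eq w hw, ← ENNReal.ofReal_mul (Real.exp_pos _).le, ← Real.exp_add,
      ← ENNReal.ofReal_one]
    refine ENNReal.ofReal_le_ofReal (Real.one_le_exp ?_)
    have := mul_le_mul_of_nonneg_left (h _ hx) (Nat.cast_nonneg (α := ℝ) (Fintype.card V))
    linarith
  · rw [Set.indicator_of_notMem (by exact hx)]
    exact zero_le

theorem ncard_microstates_le_card :
    ((microstates σ U).ncard : ℝ≥0∞) ≤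
      ENNReal.ofReal (Real.exp (Real.log (Nat.card A) * Fintype.card V)) := by
  classical
  have := Fintype.ofFinite A
  by_cases hA : Nonempty A
  · have h1 : (microstates σ U).ncard ≤ Nat.card A ^ Fintype.card V := by
      rw [← Nat.card_eq_fintype_card (α := V), ← Nat.card_fun]
      exact Set.ncard_le_card _
    have h2 : (0 : ℝ) < Nat.card A := Nat.cast_pos.2 Nat.card_pos
    rw [← Real.rpow_def_of_pos h2, Real.rpow_natCast, ENNReal.ofReal_pow h2.le,
      ENNReal.ofReal_natCast]
    exact_mod_cast h1
  -- For an empty alphabet `Real.log 0 = 0` makes the right side 1, while there are no microstates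
  -- because `V` is nonempty.
  · have : IsEmpty (V → A) := by
      rw [not_nonempty_iff] at hA
      exact ⟨fun f => hA.elim (f (Classical.arbitrary V))⟩
    simp [Set.eq_empty_of_isEmpty (microstates σ U)]

end Finite

/-! ### Growth of the mean partition function -/

section Random

variable {Γ A S : Type*} [MeasurableSpace S] [Finite A] [MeasurableSpace A]

omit [Finite A] in
theorem measurable_pullbackName [MeasurableSingletonClass A] {V : Type*} [Finite V]
    {σ : S → Γ → Equiv.Perm V}
    (hσ : ∀ (γ : Γ) (τ : Equiv.Perm V), MeasurableSet {s | σ s γ = τ}) (x : V → A) (v : V) :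
    Measurable fun s => pullbackName (σ s) x v := by
  let _ : MeasurableSpace (Equiv.Perm V) := ⊤
  refine measurable_pi_iff.2 fun γ => ?_
  have h : Measurable fun s => σ s γ := measurable_to_countable' fun τ => hσ γ τ
  exact (measurable_from_top (f := fun τ : Equiv.Perm V => x (τ v))).comp h

omit [Finite A] in
theorem measurable_empirical [MeasurableSingletonClass A] {V : Type*} [Fintype V] [Nonempty V]
    {σ : S → Γ → Equiv.Perm V}
    (hσ : ∀ (γ : Γ) (τ : Equiv.Perm V), MeasurableSet {s | σ s γ = τ}) (x : V → A) :
    Measurable fun s => empirical (σ s) x := by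
  suffices h : Measurable fun s => (empirical (σ s) x : Measure (Γ → A)) from
    Measurable.subtype_mk h
  refine Measure.measurable_of_measurable_coe _ fun B hB => ?_
  simp only [empirical_apply _ _ hB]
  exact Finset.measurable_sum _ fun v _ => measurable_const.mul
    ((measurable_one.indicator hB).comp (measurable_pullbackName hσ x v))

theorem measurable_partitionFunction [MeasurableSingletonClass A] {V : Type*} [Fintype V]
    [Nonempty V] {σ : S → Γ → Equiv.Perm V}
    (hσ : ∀ (γ : Γ) (τ : Equiv.Perm V), MeasurableSet {s | σ s γ = τ})
    {w : (Γ → A) → ℝ} (hw : Measurable w) {U : Set (ProbabilityMeasure (Γ → A))}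
    (hU : MeasurableSet U) : Measurable fun s => partitionFunction w (σ s) U := by
  classical
  refine Measurable.tsum fun x => ?_
  have h1 : Measurable fun s => ENNReal.ofReal (Real.exp (-totalEnergy w (σ s) x)) :=
    (Real.measurable_exp.comp (Finset.measurable_sum _ fun v _ =>
      hw.comp (measurable_pullbackName hσ x v)).neg).ennreal_ofReal
  exact Measurable.ite (measurable_empirical hσ x hU) h1 measurable_const

theorem le_add_of_forall_pos_le_add_coe {x y : EReal} {a : ℝ}
    (h : ∀ ε : ℝ, 0 < ε → x ≤ ((a + ε : ℝ) : EReal) + y) : x ≤ a + y := by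
  refine EReal.le_of_forall_lt_iff_le.1 fun z hz => ?_
  induction y with
  | bot => simpa using (h 1 one_pos).trans (by simp)
  | top => simp at hz
  | coe y =>
    rw [← EReal.coe_add, EReal.coe_lt_coe_iff] at hz
    have := h (z - (a + y)) (by linarith)
    rwa [← EReal.coe_add, show a + (z - (a + y)) + y = z by ring] at this

variable {V : ℕ → Type*} [∀ n, Fintype (V n)] [∀ n, Nonempty (V n)]

/-- The exponential growth rate of the mean partition function. -/
def gibbsRate (P : Measure S) (σ : ∀ n, S → Γ → Equiv.Perm (V n)) (w : (Γ → A) → ℝ)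
    (U : Set (ProbabilityMeasure (Γ → A))) : EReal :=
  growthRate V fun n => ∫⁻ s, partitionFunction w (σ n s) U ∂P

variable {P : Measure S} {σ : ∀ n, S → Γ → Equiv.Perm (V n)} {w : (Γ → A) → ℝ}

omit [Finite A] in
theorem gibbsRate_mono : Monotone (gibbsRate P σ w) := fun _ _ h =>
  growthRate_mono fun _ => lintegral_mono fun _ => partitionFunction_mono h

omit [Finite A] in
theorem gibbsRate_empty (hV : Tendsto (fun n => Fintype.card (V n)) atTop atTop) :
    gibbsRate P σ w ∅ = ⊥ := by
  simp only [gibbsRate, partitionFunction_empty, lintegral_zero]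
  exact growthRate_zero hV

variable [TopologicalSpace A] [DiscreteTopology A] [BorelSpace A] [Countable Γ]

/-- The partition function is subadditive in `U`, and a sum grows at the larger of the two rates.
Openness of `U` gives the measurability needed to split the mean. -/
theorem gibbsRate_union_lt [Group Γ] (hσ : IsRandomSoficApprox P σ) (hw : Measurable w)
    {U U' : Set (ProbabilityMeasure (Γ → A))} (hU : IsOpen U) {c : EReal}
    (h : gibbsRate P σ w U < c) (h' : gibbsRate P σ w U' < c) :
    gibbsRate P σ w (U ∪ U') < c := by
  refine growthRate_add_lt hσ.card_tendsto (fun n => ?_) h h'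
  rw [← lintegral_add_left (measurable_partitionFunction (hσ.measurable n) hw hU.measurableSet)]
  exact lintegral_mono fun s => partitionFunction_union_le

theorem isOpen_abs_integral_sub_lt (hw : Continuous w) (a ε : ℝ) :
    IsOpen {ν : ProbabilityMeasure (Γ → A) | |(∫ y, w y ∂(ν : Measure (Γ → A))) - a| < ε} := by
  have h := ProbabilityMeasure.continuous_integral_continuousMap (⟨w, hw⟩ : C(Γ → A, ℝ))
  exact isOpen_lt (h.sub continuous_const).abs continuous_const

theorem soficEntropy_le_growthRate {ν : ProbabilityMeasure (Γ → A)}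
    {O : Set (ProbabilityMeasure (Γ → A))} (hO : IsOpen O) (hν : ν ∈ O) :
    soficEntropy P σ ν ≤ growthRate V fun n => ∫⁻ s, ((microstates (σ n s) O).ncard : ℝ≥0∞) ∂P :=
  localValue_le (G := fun O : Set (ProbabilityMeasure (Γ → A)) =>
    growthRate V fun n => ∫⁻ s, ((microstates (σ n s) O).ncard : ℝ≥0∞) ∂P) hO hν

/-- The local growth rate of the mean partition function is entropy minus energy. -/
theorem localValue_gibbsRate (hV : Tendsto (fun n => Fintype.card (V n)) atTop atTop)
    (hw : Continuous w) (ν : ProbabilityMeasure (Γ → A)) :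
    localValue (gibbsRate P σ w) ν =
      soficEntropy P σ ν - ((∫ y, w y ∂(ν : Measure (Γ → A)) : ℝ) : EReal) := by
  set a : ℝ := ∫ y, w y ∂(ν : Measure (Γ → A)) with ha
  have hnear : ∀ ε : ℝ, 0 < ε → ν ∈ {ν : ProbabilityMeasure (Γ → A) |
      |(∫ y, w y ∂(ν : Measure (Γ → A))) - a| < ε} := fun ε hε => by simpa [← ha] using hε
  apply le_antisymm
  · rw [EReal.le_sub_iff_add_le (Or.inl (EReal.coe_ne_bot _)) (Or.inl (EReal.coe_ne_top _))]
    refine le_iInf₂ fun O hO => ?_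
    rw [← EReal.le_sub_iff_add_le (Or.inl (EReal.coe_ne_bot _)) (Or.inl (EReal.coe_ne_top _)),
      sub_eq_add_neg, add_comm, ← EReal.coe_neg]
    refine le_add_of_forall_pos_le_add_coe fun ε hε => ?_
    -- Shrinking `O` so that energy densities stay within `ε` of `a` makes the partition function
    -- and the microstate count comparable up to `exp ((∓a + ε)|V n|)`.
    refine (localValue_le (hO.1.inter (isOpen_abs_integral_sub_lt hw a ε))
      ⟨hO.2, hnear ε hε⟩).trans ?_
    refine growthRate_le_add hV (C := 1) (by simp) (Eventually.of_forall fun n => ?_)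
    rw [one_mul, ← lintegral_const_mul' _ _ (expCard_ne_top _ _)]
    refine lintegral_mono fun s => (partitionFunction_le hw.measurable (c := -a + ε) ?_).trans ?_
    · rintro ν' ⟨-, hν'⟩
      have h1 : |(∫ y, w y ∂(ν' : Measure (Γ → A))) - a| < ε := hν'
      have := (abs_lt.1 h1).1
      linarith
    · refine mul_le_mul_right ?_ _
      have h2 : microstates (σ n s) (O ∩ {ν : ProbabilityMeasure (Γ → A) |
          |(∫ y, w y ∂(ν : Measure (Γ → A))) - a| < ε}) ⊆ microstates (σ n s) O :=
        fun x hx => Set.inter_subset_left hx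
      exact_mod_cast Set.ncard_le_ncard h2 (Set.toFinite _)
  · refine le_iInf₂ fun O hO => ?_
    rw [EReal.sub_le_iff_le_add (Or.inl (EReal.coe_ne_bot _)) (Or.inl (EReal.coe_ne_top _)),
      add_comm]
    refine le_add_of_forall_pos_le_add_coe fun ε hε => ?_
    refine (soficEntropy_le_growthRate (hO.1.inter (isOpen_abs_integral_sub_lt hw a ε))
      ⟨hO.2, hnear ε hε⟩).trans ?_
    refine (growthRate_le_add hV (C := 1) (c := a + ε)
      (b := fun n => ∫⁻ s, partitionFunction w (σ n s) O ∂P) (by simp)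
      (Eventually.of_forall fun n => ?_))
    rw [one_mul, ← lintegral_const_mul' _ _ (expCard_ne_top _ _)]
    refine lintegral_mono fun s => (ncard_microstates_le hw.measurable (c := a + ε) ?_).trans ?_
    · rintro ν' ⟨-, hν'⟩
      have h1 : |(∫ y, w y ∂(ν' : Measure (Γ → A))) - a| < ε := hν'
      have := (abs_lt.1 h1).2
      linarith
    · exact mul_le_mul_right (partitionFunction_mono Set.inter_subset_left) _

theorem upperSemicontinuous_soficEntropy : UpperSemicontinuous
    (soficEntropy P σ : ProbabilityMeasure (Γ → A) → EReal) :=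
  upperSemicontinuous_localValue (G := fun O : Set (ProbabilityMeasure (Γ → A)) =>
    growthRate V fun n => ∫⁻ s, ((microstates (σ n s) O).ncard : ℝ≥0∞) ∂P)

theorem soficEntropy_le [IsProbabilityMeasure P]
    (hV : Tendsto (fun n => Fintype.card (V n)) atTop atTop) (ν : ProbabilityMeasure (Γ → A)) :
    soficEntropy P σ ν ≤ (Real.log (Nat.card A) : ℝ) := by
  refine (soficEntropy_le_growthRate isOpen_univ (Set.mem_univ ν)).trans ?_
  refine growthRate_le_of_eventually_le hV (C := 1) (by simp) (Eventually.of_forall fun n => ?_)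
  refine (lintegral_mono fun s => ncard_microstates_le_card).trans ?_
  simp [expCard]

end Random

/-! ### Compactness of the invariant measures on the subshift -/

section InvProb

variable {Γ A : Type*} [Group Γ] [Countable Γ] [Finite A] [TopologicalSpace A]
  [DiscreteTopology A] [MeasurableSpace A] [BorelSpace A]

omit [Countable Γ] [Finite A] [DiscreteTopology A] [MeasurableSpace A] [BorelSpace A] in
theorem continuous_shift (g : Γ) : Continuous (shift g : (Γ → A) → Γ → A) :=
  continuous_pi fun _ => continuous_apply _

theorem isClosed_isInvariant : IsClosed {ν : ProbabilityMeasure (Γ → A) | IsInvariant ν} := by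
  have h : {ν : ProbabilityMeasure (Γ → A) | IsInvariant ν} = ⋂ g : Γ,
      {ν | ν.map (measurable_shift g).aemeasurable = ν} := by
    ext ν
    simp only [Set.mem_iInter]
    exact forall_congr' fun g => ⟨fun h => ProbabilityMeasure.toMeasure_injective h,
      fun h => congrArg (fun m : ProbabilityMeasure (Γ → A) => (m : Measure (Γ → A))) h⟩
  rw [h]
  exact isClosed_iInter fun g =>
    isClosed_eq (ProbabilityMeasure.continuous_map (continuous_shift g)) continuous_id

omit [Group Γ] in
theorem isClosed_ae_mem {X : Set (Γ → A)} (hX : IsClosed X) :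
    IsClosed {ν : ProbabilityMeasure (Γ → A) | ∀ᵐ x ∂(ν : Measure (Γ → A)), x ∈ X} := by
  have h : LowerSemicontinuous fun ν : ProbabilityMeasure (Γ → A) => (ν : Measure (Γ → A)) Xᶜ := by
    intro ν c hc
    have h1 := ProbabilityMeasure.le_liminf_measure_open_of_tendsto (L := 𝓝 ν) (μ := ν) (μs := id)
      tendsto_id hX.isOpen_compl
    exact eventually_lt_of_lt_liminf (hc.trans_le h1)
  convert h.isClosed_preimage 0 using 1
  ext ν
  simp [ae_iff, Set.compl_def]

theorem isClosed_invProb {X : Set (Γ → A)} (hX : IsClosed X) : IsClosed (invProb X) :=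
  isClosed_isInvariant.inter (isClosed_ae_mem hX)

/-- A measure carried by `X` does not see the choice of the extension `w`, so its local rate is its
pressure. -/
theorem soficPressure_eq_localValue {S : Type*} [MeasurableSpace S] {P : Measure S} {V : ℕ → Type*}
    [∀ n, Fintype (V n)] [∀ n, Nonempty (V n)] {σ : ∀ n, S → Γ → Equiv.Perm (V n)}
    (hV : Tendsto (fun n => Fintype.card (V n)) atTop atTop) {X : Set (Γ → A)} (hX : IsClosed X)
    {u w : (Γ → A) → ℝ} (hw : Continuous w) (hwu : Set.EqOn w u X)
    {ν : ProbabilityMeasure (Γ → A)} (hν : ν ∈ invProb X) :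
    soficPressure P σ X u ν = localValue (gibbsRate P σ w) ν := by
  rw [localValue_gibbsRate hV hw, soficPressure, ← setIntegral_congr_fun hX.measurableSet hwu,
    Measure.restrict_eq_self_of_ae_mem hν.2]

end InvProb

/-! ### Consequences of local weak convergence -/

section Approximation

variable {Γ A S : Type*} [Group Γ] [Countable Γ] [Finite A] [TopologicalSpace A]
  [DiscreteTopology A] [MeasurableSpace A] [BorelSpace A] [MeasurableSpace S]

omit [Group Γ] in
theorem exists_integral_bounds {w : (Γ → A) → ℝ} (hw : Continuous w) :
    ∃ B : ℝ, ∀ ν : ProbabilityMeasure (Γ → A), |∫ y, w y ∂(ν : Measure (Γ → A))| ≤ B := by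
  have h := ProbabilityMeasure.continuous_integral_continuousMap (⟨w, hw⟩ : C(Γ → A, ℝ))
  obtain ⟨B, hB⟩ := isCompact_univ.exists_bound_of_continuousOn (f := fun ν : ProbabilityMeasure
    (Γ → A) => ∫ y, w y ∂(ν : Measure (Γ → A))) h.continuousOn
  exact ⟨B, fun ν => hB ν (Set.mem_univ ν)⟩

omit [Group Γ] [Countable Γ] [TopologicalSpace A] [DiscreteTopology A] [BorelSpace A] in
-- A microstate charged by the Gibbs state with empirical measure off `N` must have it in `U₁`, so
-- the total weight of these microstates is at most `Z(U₁)`.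
theorem gibbsState_map_empirical_compl_le {V : Type*} [Fintype V] [Nonempty V]
    {w : (Γ → A) → ℝ} {σ : Γ → Equiv.Perm V} {U U₁ N : Set (ProbabilityMeasure (Γ → A))}
    (hN : MeasurableSet N) (hU : U ⊆ N ∪ U₁) (h : (microstates σ U).Nonempty) :
    ((gibbsState w σ U h).map (empirical σ)).toMeasure Nᶜ ≤
      partitionFunction w σ U₁ * (partitionFunction w σ U)⁻¹ := by
  let _ : MeasurableSpace (V → A) := ⊤
  rw [PMF.toMeasure_map_apply _ _ _ measurable_from_top hN.compl,
    PMF.toMeasure_apply (hs := MeasurableSpace.measurableSet_top), partitionFunction,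
    ← ENNReal.tsum_mul_right]
  refine ENNReal.tsum_le_tsum fun x => ?_
  by_cases hx : empirical σ x ∈ N
  · rw [Set.indicator_of_notMem (by exact fun h => h hx)]
    exact zero_le
  · rw [Set.indicator_of_mem (by exact hx), gibbsState_apply]
    refine mul_le_mul_left ?_ _
    by_cases hxU : empirical σ x ∈ U
    · rw [gibbsWeight_of_mem hxU, gibbsWeight_of_mem ((hU hxU).resolve_left hx)]
    · rw [gibbsWeight_of_notMem hxU]
      exact zero_le

variable {P : Measure S} [IsProbabilityMeasure P] {V : ℕ → Type*} [∀ n, Fintype (V n)]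
  [∀ n, Nonempty (V n)] {σ : ∀ n, S → Γ → Equiv.Perm (V n)} {X : Set (Γ → A)} {w : (Γ → A) → ℝ}
  {μ : ProbabilityMeasure (Γ → A)}

/-- The event that the restricted Gibbs state does not exist or is not close to the limit. -/
def badEvent (σ : ∀ n, S → Γ → Equiv.Perm (V n)) (w : (Γ → A) → ℝ)
    (U O : Set (ProbabilityMeasure (Γ → A))) (n : ℕ) : Set S :=
  {s | ¬ ∃ h : (microstates (σ n s) U).Nonempty,
    gibbsState w (σ n s) U h ∈ randomMicrostates (σ n s) O}

omit [IsProbabilityMeasure P] in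
theorem IsLocalWeakLimit.eventually_growthRate_lt (hμ : IsLocalWeakLimit P σ X w μ)
    {O : Set (ProbabilityMeasure (Γ → A))} (hO : IsOpen O) (hμO : μ ∈ O) (c : ℝ) :
    ∀ᶠ U in openNhds (invProb X), growthRate V (fun n => P (badEvent σ w U O n)) < c :=
  eventually_lt_of_limsup_lt ((hμ O hO hμO).trans_lt (EReal.bot_lt_coe c))

/-- Otherwise `U = ∅` would be an admissible neighbourhood, for which the Gibbs state never exists:
the bad event has probability 1 and rate 0 instead of a negative rate. -/
theorem IsLocalWeakLimit.invProb_nonempty (hμ : IsLocalWeakLimit P σ X w μ) :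
    (invProb X : Set (ProbabilityMeasure (Γ → A))).Nonempty := by
  rw [Set.nonempty_iff_ne_empty]
  intro hK
  obtain ⟨U, hU1, hU2⟩ := ((hμ.eventually_growthRate_lt isOpen_univ (Set.mem_univ μ) 0).and
    (eventually_openNhds isOpen_empty hK.subset)).exists
  have hUe : U = ∅ := Set.subset_empty_iff.1 hU2.2.2
  have h1 : (fun n => P (badEvent σ w U Set.univ n)) = fun _ => 1 := by
    funext n
    have : badEvent σ w U Set.univ n = Set.univ := by
      refine Set.eq_univ_of_forall fun s => ?_
      rintro ⟨⟨x, hx⟩, -⟩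
      rw [hUe] at hx
      exact hx
    rw [this, measure_univ]
  rw [h1, growthRate_one] at hU1
  exact lt_irrefl _ hU1

/-- With probability at least 1/2 some microstate exists, and a single one contributes at least `exp
(-B|V n|)`. The rate `-1` below could be any negative number. -/
theorem IsLocalWeakLimit.le_gibbsRate (hσ : IsRandomSoficApprox P σ) (hw : Continuous w) {B : ℝ}
    (hB : ∀ ν : ProbabilityMeasure (Γ → A), |∫ y, w y ∂(ν : Measure (Γ → A))| ≤ B)
    (hμ : IsLocalWeakLimit P σ X w μ) :
    ∀ᶠ U in openNhds (invProb X), ((-B : ℝ) : EReal) ≤ gibbsRate P σ w U := by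
  filter_upwards [hμ.eventually_growthRate_lt isOpen_univ (Set.mem_univ μ) (-1),
    eventually_openNhds isOpen_univ (Set.subset_univ (invProb X))] with U hU hUo
  have hV := hσ.card_tendsto
  suffices h : growthRate V (fun _ => 1) ≤ (B : EReal) + gibbsRate P σ w U by
    rw [growthRate_one, add_comm] at h
    have := (EReal.sub_le_iff_le_add (Or.inl (EReal.coe_ne_bot B)) (Or.inl (EReal.coe_ne_top B))).2 h
    simpa using this
  refine growthRate_le_add hV (C := 2) (by simp) ?_
  filter_upwards [eventually_lt_expCard_of_growthRate_lt hV hU,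
    eventually_le_expCard hV one_pos (C := 2) (by simp)] with n hn1 hn2
  have hZ : Measurable fun s => partitionFunction w (σ n s) U :=
    measurable_partitionFunction (hσ.measurable n) hw.measurable hUo.1.measurableSet
  -- A measurable substitute for the event that the Gibbs state exists; the bad event itself is not
  -- known to be measurable.
  let T : Set S := {s | partitionFunction w (σ n s) U ≠ 0}
  have hT : MeasurableSet T := (hZ (measurableSet_singleton 0)).compl
  have hTc : P Tᶜ ≤ 2⁻¹ := by
    have h1 : Tᶜ ⊆ badEvent σ w U Set.univ n := by
      rintro s hs ⟨h, -⟩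
      exact hs (partitionFunction_ne_zero h)
    refine (measure_mono h1).trans (hn1.le.trans ?_)
    have h2 : expCard V (-1) n * expCard V 1 n = 1 := by
      rw [← expCard_add]
      simp [expCard]
    rw [ENNReal.eq_inv_of_mul_eq_one_left h2]
    exact ENNReal.inv_le_inv.2 hn2
  have hTP : 1 ≤ 2 * P T := by
    have h1 : 1 ≤ P T + 2⁻¹ := by
      rw [← prob_add_prob_compl (μ := P) hT]
      gcongr
    have h2 : (1 : ℝ≥0∞) - 2⁻¹ ≤ P T := tsub_le_iff_right.2 h1
    rw [ENNReal.one_sub_inv_two] at h2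
    calc (1 : ℝ≥0∞) = 2 * 2⁻¹ := (ENNReal.mul_inv_cancel (by simp) (by simp)).symm
      _ ≤ 2 * P T := by gcongr
  have hlow : ∀ s ∈ T, expCard V (-B) n ≤ partitionFunction w (σ n s) U := by
    intro s hs
    obtain ⟨x, hx⟩ : (microstates (σ n s) U).Nonempty := by
      by_contra h
      exact hs (partitionFunction_eq_zero h)
    refine le_trans ?_ (ENNReal.le_tsum x)
    rw [gibbsWeight_of_mem (U := U) hx, totalEnergy_eq w hw.measurable]
    refine ENNReal.ofReal_le_ofReal (Real.exp_le_exp.2 ?_)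
    have := mul_le_mul_of_nonneg_left ((abs_le.1 (hB (empirical (σ n s) x))).2)
      (Nat.cast_nonneg (α := ℝ) (Fintype.card (V n)))
    linarith
  have hint : expCard V (-B) n * P T ≤ ∫⁻ s, partitionFunction w (σ n s) U ∂P := by
    rw [← lintegral_indicator_const hT]
    refine lintegral_mono fun s => ?_
    by_cases hs : s ∈ T
    · rw [Set.indicator_of_mem hs]
      exact hlow s hs
    · rw [Set.indicator_of_notMem hs]
      exact zero_le
  have hone : expCard V B n * expCard V (-B) n = 1 := by
    rw [← expCard_add]
    simp [expCard]
  calc (1 : ℝ≥0∞) ≤ 2 * P T := hTP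
    _ = 2 * expCard V B n * (expCard V (-B) n * P T) := by
      rw [mul_assoc, ← mul_assoc (expCard V B n), hone, one_mul]
    _ ≤ _ := by gcongr

omit [Group Γ] in
theorem partitionFunction_le_expCard (hw : Continuous w) {B : ℝ}
    (hB : ∀ ν : ProbabilityMeasure (Γ → A), |∫ y, w y ∂(ν : Measure (Γ → A))| ≤ B) (n : ℕ)
    (τ : Γ → Equiv.Perm (V n)) (U : Set (ProbabilityMeasure (Γ → A))) :
    partitionFunction w τ U ≤ expCard V (B + Real.log (Nat.card A)) n := by
  rw [expCard_add]
  refine (partitionFunction_le hw.measurable fun ν _ => (abs_le.1 (hB ν)).1).trans ?_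
  exact mul_le_mul_right ncard_microstates_le_card _

omit [IsProbabilityMeasure P] in
/-- Near the limit there are laws of empirical measures of Gibbs states that are concentrated near
the set where the local growth rate is at least `m`. -/
theorem IsLocalWeakLimit.exists_bary_mem (hσ : IsRandomSoficApprox P σ) (hX : IsClosed X)
    (hw : Continuous w) (hμ : IsLocalWeakLimit P σ X w μ) {ν₀ : ProbabilityMeasure (Γ → A)}
    (hν₀ : ν₀ ∈ invProb X) (hbot : ⊥ < localValue (gibbsRate P σ w) ν₀)
    {O N : Set (ProbabilityMeasure (Γ → A))} (hO : IsOpen O) (hμO : μ ∈ O) (hN : IsOpen N)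
    (hKN : ∀ ν ∈ invProb X, localValue (gibbsRate P σ w) ν₀ ≤ localValue (gibbsRate P σ w) ν →
      ν ∈ N) {δ : ℝ≥0∞} (hδ : 0 < δ) :
    ∃ q : ProbabilityMeasure (ProbabilityMeasure (Γ → A)), bary q ∈ O ∧
      (q : Measure (ProbabilityMeasure (Γ → A))) Nᶜ ≤ δ := by
  have hV := hσ.card_tendsto
  obtain ⟨B, hB⟩ := exists_integral_bounds hw
  set m := localValue (gibbsRate P σ w) ν₀ with hm
  have hKc : IsCompact (invProb X \ N) := ((isClosed_invProb hX).sdiff hN).isCompact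
  -- Off `N` all local values lie strictly below `m`, and compactness makes this uniform in one open
  -- set.
  obtain ⟨U₁, hU₁, hKU₁, hG₁⟩ := exists_open_lt_of_localValue_lt (G := gibbsRate P σ w)
    (gibbsRate_empty hV) (fun U U' c hU _ h h' => gibbsRate_union_lt hσ hw.measurable hU h h') hKc
    hbot fun ν hν => lt_of_not_ge fun h => hν.2 (hKN ν hν.1 h)
  obtain ⟨d₁, hd₁, hd₁m⟩ := EReal.lt_iff_exists_real_btwn.1 hG₁
  obtain ⟨d₂, hd₂, hd₂m⟩ := EReal.lt_iff_exists_real_btwn.1 hd₁m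
  have hd : 0 < d₂ - d₁ := sub_pos.2 (EReal.coe_lt_coe_iff.1 hd₂)
  set L : ℝ := B + Real.log (Nat.card A) with hL
  have hcover : invProb X ⊆ N ∪ U₁ := fun ν hν => by
    by_cases h : ν ∈ N
    · exact Or.inl h
    · exact Or.inr (hKU₁ ⟨hν, h⟩)
  -- The rate `d₁ - L` is chosen so that the bad event, where only `Z ≤ exp (L|V n|)` is available,
  -- contributes at most `exp (d₁|V n|)`. The gap `d₂ - d₁` later absorbs the factor `1 + δ⁻¹`.
  obtain ⟨U, hbad, hUo, hKU, hUN⟩ := ((hμ.eventually_growthRate_lt hO hμO (d₁ - L)).and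
    (eventually_openNhds (hN.union hU₁) hcover)).exists
  have hUm : (d₂ : EReal) < gibbsRate P σ w U := hd₂m.trans_le (localValue_le hUo (hKU hν₀))
  obtain ⟨n, hn2, hn1, hnb, hnC⟩ := ((frequently_expCard_lt_of_lt_growthRate hV hUm).and_eventually
    ((eventually_lt_expCard_of_growthRate_lt hV hd₁).and
      ((eventually_lt_expCard_of_growthRate_lt hV hbad).and
        (eventually_le_expCard hV hd (C := 1 + δ⁻¹) (by simp [hδ.ne']))))).exists
  by_contra hcon
  push Not at hcon
  -- Off the bad event the barycenter lies in `O`, so by assumption the mass off `N` exceeds `δ`;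
  -- being at most `Z(U₁)/Z(U)`, it forces `Z(U) ≤ δ⁻¹ Z(U₁)`.
  have hpt : ∀ s, partitionFunction w (σ n s) U ≤
      (badEvent σ w U O n).indicator (fun _ => expCard V L n) s +
        δ⁻¹ * partitionFunction w (σ n s) U₁ := by
    intro s
    by_cases hs : s ∈ badEvent σ w U O n
    · rw [Set.indicator_of_mem hs]
      exact (partitionFunction_le_expCard hw hB n (σ n s) U).trans le_self_add
    · rw [Set.indicator_of_notMem hs, zero_add]
      obtain ⟨h, hξ⟩ := not_not.1 hs
      have h1 : bary ⟨((gibbsState w (σ n s) U h).map (empirical (σ n s))).toMeasure,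
          inferInstance⟩ ∈ O := by
        rw [← avgEmpirical_eq_bary]
        exact hξ
      have h2 := (hcon _ h1).trans_le (gibbsState_map_empirical_compl_le hN.measurableSet hUN h)
      have h3 : δ ≠ ⊤ := ne_top_of_lt h2
      rw [← div_eq_mul_inv] at h2
      have h4 := ENNReal.mul_le_of_le_div h2.le
      rwa [← ENNReal.div_eq_inv_mul, ENNReal.le_div_iff_mul_le (Or.inl hδ.ne') (Or.inl h3), mul_comm]
  have hZ₁ : Measurable fun s => partitionFunction w (σ n s) U₁ :=
    measurable_partitionFunction (hσ.measurable n) hw.measurable hU₁.measurableSet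
  have hint : ∫⁻ s, partitionFunction w (σ n s) U ∂P ≤ expCard V d₂ n := by
    calc ∫⁻ s, partitionFunction w (σ n s) U ∂P
        ≤ ∫⁻ s, (badEvent σ w U O n).indicator (fun _ => expCard V L n) s ∂P +
            ∫⁻ s, δ⁻¹ * partitionFunction w (σ n s) U₁ ∂P := by
          rw [← lintegral_add_right _ (hZ₁.const_mul _)]
          exact lintegral_mono hpt
      _ ≤ expCard V L n * P (badEvent σ w U O n) +
            δ⁻¹ * ∫⁻ s, partitionFunction w (σ n s) U₁ ∂P := by
          rw [lintegral_const_mul _ hZ₁]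
          gcongr
          -- This inequality needs no measurability of the bad event.
          exact lintegral_indicator_const_le _ _
      _ ≤ expCard V L n * expCard V (d₁ - L) n + δ⁻¹ * expCard V d₁ n := by
          gcongr
      _ = (1 + δ⁻¹) * expCard V d₁ n := by
          rw [← expCard_add, add_sub_cancel, add_mul, one_mul]
      _ ≤ expCard V (d₂ - d₁) n * expCard V d₁ n := by gcongr
      _ = expCard V d₂ n := by rw [← expCard_add, sub_add_cancel]
  exact absurd hn2 (not_lt.2 hint)

/-- The maximal local growth rate on the invariant measures is finite. -/
theorem IsLocalWeakLimit.exists_max (hσ : IsRandomSoficApprox P σ) (hX : IsClosed X)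
    (hw : Continuous w) (hμ : IsLocalWeakLimit P σ X w μ) :
    ∃ (m : ℝ) (ν₀ : ProbabilityMeasure (Γ → A)), ν₀ ∈ invProb X ∧
      localValue (gibbsRate P σ w) ν₀ = m ∧
      (∀ ν ∈ invProb X, localValue (gibbsRate P σ w) ν ≤ m) ∧
      Tendsto (gibbsRate P σ w) (openNhds (invProb X)) (𝓝 (m : EReal)) := by
  have hV := hσ.card_tendsto
  obtain ⟨B, hB⟩ := exists_integral_bounds hw
  obtain ⟨ν₀, hν₀, hmax, hlim⟩ := exists_isGreatest_tendsto_openNhds (G := gibbsRate P σ w)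
    gibbsRate_mono (gibbsRate_empty hV)
    (fun U U' c hU _ h h' => gibbsRate_union_lt hσ hw.measurable hU h h')
    (isClosed_invProb hX).isCompact hμ.invProb_nonempty
  have h1 : ((-B : ℝ) : EReal) ≤ localValue (gibbsRate P σ w) ν₀ :=
    ge_of_tendsto hlim (hμ.le_gibbsRate hσ hw hB)
  have h2 : localValue (gibbsRate P σ w) ν₀ ≠ ⊤ := by
    rw [localValue_gibbsRate hV hw]
    have h3 := EReal.sub_le_sub (soficEntropy_le (P := P) (σ := σ) hV ν₀)
      (le_refl ((∫ y, w y ∂(ν₀ : Measure (Γ → A)) : ℝ) : EReal))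
    rw [← EReal.coe_sub] at h3
    exact ne_top_of_le_ne_top (EReal.coe_ne_top _) h3
  have h3 : localValue (gibbsRate P σ w) ν₀ ≠ ⊥ :=
    fun h => absurd (h ▸ h1) (not_le.2 (EReal.bot_lt_coe _))
  have h4 := EReal.coe_toReal h2 h3
  exact ⟨_, ν₀, hν₀, h4.symm, fun ν hν => h4.symm ▸ hmax ν hν, h4.symm ▸ hlim⟩

end Approximation

/-! ### The equality case of an integral inequality -/

section Equality

/-- A function below an integrable bound whose integral is at least that of the bound equals the
bound almost everywhere. -/
theorem ae_le_of_integral_le_eintegral {T : Type*} [MeasurableSpace T] {θ : Measure T}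
    {h : T → EReal} (hh : Measurable h) {g : T → ℝ} (hg : Integrable g θ)
    (hle : ∀ᵐ t ∂θ, h t ≤ g t) (hint : ((∫ t, g t ∂θ : ℝ) : EReal) ≤ eintegral θ h) :
    ∀ᵐ t ∂θ, (g t : EReal) ≤ h t := by
  have hpos : ∀ᵐ t ∂θ, (h t).toENNReal ≤ ENNReal.ofReal (g t) := by
    filter_upwards [hle] with t ht
    rw [← EReal.toReal_coe (g t), ← EReal.toENNReal_of_ne_top (EReal.coe_ne_top _)]
    exact EReal.toENNReal_le_toENNReal ht
  have hneg : ∀ᵐ t ∂θ, ENNReal.ofReal (-g t) ≤ (-h t).toENNReal := by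
    filter_upwards [hle] with t ht
    rw [← EReal.toReal_coe (-g t), ← EReal.toENNReal_of_ne_top (EReal.coe_ne_top _), EReal.coe_neg]
    exact EReal.toENNReal_le_toENNReal (EReal.neg_le_neg_iff.2 ht)
  have hGp : ∫⁻ t, ENNReal.ofReal (g t) ∂θ ≠ ⊤ := hg.lintegral_lt_top.ne
  have hGn : ∫⁻ t, ENNReal.ofReal (-g t) ∂θ ≠ ⊤ := hg.neg.lintegral_lt_top.ne
  have ha := lintegral_mono_ae hpos
  have hb := lintegral_mono_ae hneg
  rw [integral_eq_lintegral_pos_part_sub_lintegral_neg_part hg, eintegral] at hint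
  have haT : ∫⁻ t, (h t).toENNReal ∂θ ≠ ⊤ := ne_top_of_le_ne_top hGp ha
  have hbT : ∫⁻ t, (-h t).toENNReal ∂θ ≠ ⊤ := by
    intro hb'
    rw [hb', EReal.coe_ennreal_top, EReal.sub_top, le_bot_iff] at hint
    exact EReal.coe_ne_bot _ hint
  set a := ∫⁻ t, (h t).toENNReal ∂θ
  set b := ∫⁻ t, (-h t).toENNReal ∂θ
  set c := ∫⁻ t, ENNReal.ofReal (g t) ∂θ
  set d := ∫⁻ t, ENNReal.ofReal (-g t) ∂θ
  have hreal : c.toReal - d.toReal ≤ a.toReal - b.toReal := by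
    rw [← ENNReal.ofReal_toReal haT, ← ENNReal.ofReal_toReal hbT,
      EReal.coe_ennreal_ofReal, EReal.coe_ennreal_ofReal, max_eq_left ENNReal.toReal_nonneg,
      max_eq_left ENNReal.toReal_nonneg, ← EReal.coe_sub, EReal.coe_le_coe_iff] at hint
    exact hint
  have ha' := ENNReal.toReal_mono hGp ha
  have hb' := ENNReal.toReal_mono hbT hb
  -- From `a ≤ c`, `d ≤ b` and `c - d ≤ a - b` it follows that `a = c` and `b = d`: positive and
  -- negative parts have equal integrals, hence agree almost everywhere.
  have hca : c ≤ a := (ENNReal.toReal_le_toReal hGp haT).1 (by linarith)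
  have hbd : b ≤ d := (ENNReal.toReal_le_toReal hbT hGn).1 (by linarith)
  have hEq1 := ae_eq_of_ae_le_of_lintegral_le hpos haT hg.aemeasurable.ennreal_ofReal hca
  have hEq2 := ae_eq_of_ae_le_of_lintegral_le hneg hGn
    hh.neg.ereal_toENNReal.aemeasurable hbd
  filter_upwards [hEq1, hEq2] with t h1 h2
  generalize h t = y at h1 h2
  induction y with
  | bot => simp at h2
  | top => exact le_top
  | coe y =>
    rw [← EReal.coe_neg, EReal.toENNReal_of_ne_top (EReal.coe_ne_top _), EReal.toReal_coe] at h2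
    rw [EReal.toENNReal_of_ne_top (EReal.coe_ne_top _), EReal.toReal_coe] at h1
    rw [EReal.coe_le_coe_iff]
    by_contra hlt
    rw [not_le] at hlt
    rcases lt_or_ge 0 (g t) with h0 | h0
    · exact h1.not_lt ((ENNReal.ofReal_lt_ofReal_iff h0).2 hlt)
    · exact h2.not_lt ((ENNReal.ofReal_lt_ofReal_iff (by linarith)).2 (by linarith))

end Equality

/-! ### Barycenters, invariance and disintegrations -/

section ErgodicDecomposition

variable {Γ A : Type*} [Group Γ] [Countable Γ] [Finite A] [TopologicalSpace A]
  [DiscreteTopology A] [MeasurableSpace A] [BorelSpace A]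

omit [Group Γ] [Countable Γ] [Finite A] [TopologicalSpace A] [DiscreteTopology A] [BorelSpace A] in
theorem ae_ae_of_bind_eq {p : Measure (ProbabilityMeasure (Γ → A))}
    {μ : ProbabilityMeasure (Γ → A)} (h : (p.bind fun ν => (ν : Measure (Γ → A))) = μ)
    {B : Set (Γ → A)} (hB : (μ : Measure (Γ → A)) B = 0) :
    ∀ᵐ ν ∂p, ((ν : ProbabilityMeasure (Γ → A)) : Measure (Γ → A)) B = 0 := by
  have h1 : ∀ᵐ x ∂(p.bind fun ν => (ν : Measure (Γ → A))), x ∉ B := by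
    rw [h]
    exact measure_eq_zero_iff_ae_notMem.1 hB
  filter_upwards [Measure.ae_ae_of_ae_bind measurable_toMeasure.aemeasurable h1] with ν hν
  exact measure_eq_zero_iff_ae_notMem.2 hν

omit [Countable Γ] [Finite A] [TopologicalSpace A] [DiscreteTopology A] [BorelSpace A] in
theorem isInvariant_of_bind_eq {p : Measure (ProbabilityMeasure (Γ → A))}
    {μ : ProbabilityMeasure (Γ → A)} (h : (p.bind fun ν => (ν : Measure (Γ → A))) = μ)
    (hp : ∀ᵐ ν ∂p, IsInvariant ν) : IsInvariant μ := by
  intro g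
  refine Measure.ext fun B hB => ?_
  have hB' := measurable_shift g hB
  rw [Measure.map_apply (measurable_shift g) hB, ← h,
    Measure.bind_apply hB' measurable_toMeasure.aemeasurable,
    Measure.bind_apply hB measurable_toMeasure.aemeasurable]
  refine lintegral_congr_ae ?_
  filter_upwards [hp] with ν hν
  exact (hν.measurePreserving g).measure_preimage hB.nullMeasurableSet

omit [Group Γ] [Countable Γ] [Finite A] [TopologicalSpace A] [DiscreteTopology A] [BorelSpace A] in
theorem map_bind_toMeasure {κ : (Γ → A) → ProbabilityMeasure (Γ → A)} (hκ : Measurable κ)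
    (ν : Measure (Γ → A)) : ((ν.map κ).bind fun ρ => (ρ : Measure (Γ → A))) =
      ν.bind fun x => (κ x : Measure (Γ → A)) := by
  refine Measure.ext fun B hB => ?_
  have hκ' : Measurable fun x => (κ x : Measure (Γ → A)) := measurable_toMeasure.comp hκ
  rw [Measure.bind_apply hB measurable_toMeasure.aemeasurable,
    Measure.bind_apply hB hκ'.aemeasurable,
    lintegral_map (measurable_probabilityMeasure_apply hB) hκ]

/-- The image of a measure under an ergodic disintegration is its ergodic decomposition. -/
theorem isErgodicDecomposition_map {κ : (Γ → A) → ProbabilityMeasure (Γ → A)} (hκ : Measurable κ)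
    {D : Set (Γ → A)} (hD : ∀ x ∈ D, IsErgodic (κ x)) {ν : ProbabilityMeasure (Γ → A)}
    (hνD : (ν : Measure (Γ → A)) Dᶜ = 0)
    (hbind : (ν : Measure (Γ → A)).bind (fun x => (κ x : Measure (Γ → A))) = ν) :
    IsErgodicDecomposition ((ν : Measure (Γ → A)).map κ) ν := by
  have hprob : IsProbabilityMeasure ((ν : Measure (Γ → A)).map κ) :=
    Measure.isProbabilityMeasure_map hκ.aemeasurable
  refine ⟨hprob, ?_, fun f => ?_, fun E hE hEe => ?_⟩
  · rw [ae_map_iff hκ.aemeasurable isClosed_isInvariant.measurableSet]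
    filter_upwards [mem_ae_iff.2 hνD] with x hx
    exact (hD x hx).1
  · rw [← integral_bind_toMeasure, map_bind_toMeasure hκ, hbind]
  · rw [Measure.map_apply hκ hE]
    exact measure_mono_null (fun x hx hxD => hEe _ hx (hD x hxD)) hνD

end ErgodicDecomposition

/-! ### Ergodic components of maximizers -/

section Equilibrium

variable {Γ A S : Type*} [Group Γ] [Countable Γ] [Finite A] [TopologicalSpace A]
  [DiscreteTopology A] [MeasurableSpace A] [BorelSpace A] [MeasurableSpace S]
  {P : Measure S} {V : ℕ → Type*} [∀ n, Fintype (V n)]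
  [∀ n, Nonempty (V n)] {σ : ∀ n, S → Γ → Equiv.Perm (V n)} {X : Set (Γ → A)} {w : (Γ → A) → ℝ}

/-- The invariant measures on `X` for which entropy minus energy is at least `m`. -/
def maximizers (P : Measure S) (σ : ∀ n, S → Γ → Equiv.Perm (V n)) (X : Set (Γ → A))
    (w : (Γ → A) → ℝ) (m : ℝ) : Set (ProbabilityMeasure (Γ → A)) :=
  {ν | ν ∈ invProb X ∧ (m : EReal) ≤ localValue (gibbsRate P σ w) ν}

theorem isClosed_maximizers (hX : IsClosed X) (m : ℝ) : IsClosed (maximizers P σ X w m) :=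
  (isClosed_invProb hX).inter (upperSemicontinuous_localValue.isClosed_preimage (m : EReal))

/-- For a good sofic approximation, almost every ergodic component of a maximizing measure is
maximizing. -/
theorem IsGood.ae_mem_maximizers (hgood : IsGood A P σ)
    (hV : Tendsto (fun n => Fintype.card (V n)) atTop atTop) (hX : IsClosed X) (hw : Continuous w)
    {m : ℝ} (hmax : ∀ ν ∈ invProb X, localValue (gibbsRate P σ w) ν ≤ m)
    {κ : (Γ → A) → ProbabilityMeasure (Γ → A)} (hκ : Measurable κ) {D : Set (Γ → A)}
    (hD : ∀ x ∈ D, IsErgodic (κ x)) {ν : ProbabilityMeasure (Γ → A)}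
    (hν : ν ∈ maximizers P σ X w m) (hνD : (ν : Measure (Γ → A)) Dᶜ = 0)
    (hbind : (ν : Measure (Γ → A)).bind (fun x => (κ x : Measure (Γ → A))) = ν) :
    ∀ᵐ x ∂(ν : Measure (Γ → A)), κ x ∈ maximizers P σ X w m := by
  have hθ := isErgodicDecomposition_map hκ hD hνD hbind
  have hprob := hθ.prob
  have hent := hgood ν hν.1.1 _ hθ
  have hcont : Continuous fun ρ : ProbabilityMeasure (Γ → A) => ∫ y, w y ∂(ρ : Measure (Γ → A)) :=
    ProbabilityMeasure.continuous_integral_continuousMap (⟨w, hw⟩ : C(Γ → A, ℝ))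
  have hcont' : Continuous fun ρ : ProbabilityMeasure (Γ → A) =>
      m + ∫ y, w y ∂(ρ : Measure (Γ → A)) := continuous_const.add hcont
  have hintw : Integrable (fun ρ : ProbabilityMeasure (Γ → A) => ∫ y, w y ∂(ρ : Measure (Γ → A)))
      ((ν : Measure (Γ → A)).map κ) :=
    hcont.integrable_of_hasCompactSupport (HasCompactSupport.of_compactSpace _)
  have hK : ∀ᵐ x ∂(ν : Measure (Γ → A)), κ x ∈ invProb X := by
    have h1 : ∀ᵐ x ∂(ν : Measure (Γ → A)), ∀ᵐ y ∂(κ x : Measure (Γ → A)), y ∈ X := by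
      refine Measure.ae_ae_of_ae_bind (measurable_toMeasure.comp hκ).aemeasurable ?_
      rw [hbind]
      exact hν.1.2
    filter_upwards [h1, mem_ae_iff.2 hνD] with x hx1 hx2
    exact ⟨(hD x hx2).1, hx1⟩
  have hmeasK : MeasurableSet (invProb X : Set (ProbabilityMeasure (Γ → A))) :=
    (isClosed_invProb hX).measurableSet
  have hKθ : ∀ᵐ ρ ∂((ν : Measure (Γ → A)).map κ), ρ ∈ invProb X :=
    (ae_map_iff hκ.aemeasurable hmeasK).2 hK
  have hle : ∀ᵐ ρ ∂((ν : Measure (Γ → A)).map κ), soficEntropy P σ ρ ≤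
      ((m + ∫ y, w y ∂(ρ : Measure (Γ → A)) : ℝ) : EReal) := by
    filter_upwards [hKθ] with ρ hρ
    have h1 := hmax ρ hρ
    rw [localValue_gibbsRate hV hw, EReal.sub_le_iff_le_add (Or.inl (EReal.coe_ne_bot _))
      (Or.inl (EReal.coe_ne_top _)), ← EReal.coe_add] at h1
    exact h1
  -- Energy is affine, so the bound `m + ∫ w dρ` integrates to `m + ∫ w dν`. This is at most
  -- `h_Σ(ν)` since `ν` is a maximizer, and goodness bounds `h_Σ(ν)` by the mean entropy.
  have hint : ((∫ ρ, (m + ∫ y, w y ∂(ρ : Measure (Γ → A))) ∂((ν : Measure (Γ → A)).map κ) : ℝ) :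
      EReal) ≤ eintegral ((ν : Measure (Γ → A)).map κ) (soficEntropy P σ) := by
    refine le_trans ?_ hent
    have h1 := hν.2
    rw [localValue_gibbsRate hV hw, EReal.le_sub_iff_add_le (Or.inl (EReal.coe_ne_bot _))
      (Or.inl (EReal.coe_ne_top _)), ← EReal.coe_add] at h1
    have h2 : ∫ y, w y ∂(ν : Measure (Γ → A)) = ∫ ρ, (∫ y, w y ∂((ρ : ProbabilityMeasure (Γ → A)) :
        Measure (Γ → A))) ∂((ν : Measure (Γ → A)).map κ) := hθ.barycenter ⟨w, hw⟩
    rw [integral_add (integrable_const _) hintw, integral_const, probReal_univ, one_smul, ← h2]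
    exact h1
  have hres := ae_le_of_integral_le_eintegral upperSemicontinuous_soficEntropy.measurable
    ((integrable_const m).add hintw) hle hint
  have hres' := ae_of_ae_map hκ.aemeasurable hres
  filter_upwards [hres', hK] with x hx1 hx2
  refine ⟨hx2, ?_⟩
  rw [localValue_gibbsRate hV hw, EReal.le_sub_iff_add_le (Or.inl (EReal.coe_ne_bot _))
      (Or.inl (EReal.coe_ne_top _)), ← EReal.coe_add]
  exact hx1

end Equilibrium

end SoficPressure

end

/-! ### The main theorem -/

theorem mainTheorem4
    {Γ A S : Type*} [Group Γ] [Countable Γ]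
    [Finite A] [TopologicalSpace A] [DiscreteTopology A] [MeasurableSpace A] [BorelSpace A]
    -- the random maps `σ n : Γ → Sym(V n)`
    [MeasurableSpace S] (P : Measure S) [IsProbabilityMeasure P]
    {V : ℕ → Type*} [∀ n, Fintype (V n)] [∀ n, Nonempty (V n)]
    (σ : ∀ n, S → Γ → Equiv.Perm (V n)) (hσ : IsRandomSoficApprox P σ)
    -- the subshift, the energy on it, and a continuous extension `w` of the energy
    (X : Set (Γ → A)) (hX : IsSubshift X)
    (u : (Γ → A) → ℝ) (hu : ContinuousOn u X)
    (w : (Γ → A) → ℝ) (hw : Continuous w) (hwu : Set.EqOn w u X)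
    (μ : ProbabilityMeasure (Γ → A)) (hμ : IsLocalWeakLimit P σ X w μ) :
    (∃ p : Measure (ProbabilityMeasure (Γ → A)), IsProbabilityMeasure p ∧
      (∀ᵐ ν ∂p, ν ∈ invProb X) ∧ IsBarycenter p μ ∧ ∀ᵐ ν ∂p, IsEquilibrium P σ X u ν) ∧
    (∃ m : EReal, IsGreatest (soficPressure P σ X u '' invProb X) m ∧
      Tendsto (fun U : Set (ProbabilityMeasure (Γ → A)) =>
        growthRate V fun n => ∫⁻ s, expGibbsPressure w (σ n s) U ∂P)
        (openNhds (invProb X)) (𝓝 m)) ∧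
    (IsGood A P σ →
      (∃ θ : Measure (ProbabilityMeasure (Γ → A)), IsErgodicDecomposition θ μ) ∧
      ∀ θ : Measure (ProbabilityMeasure (Γ → A)), IsErgodicDecomposition θ μ →
        ∀ᵐ ν ∂θ, IsEquilibrium P σ X u ν) := by
  have hV := hσ.card_tendsto
  have hXc := hX.1
  obtain ⟨m, ν₀, hν₀, hmν₀, hmax, hlim⟩ := hμ.exists_max hσ hXc hw
  have hpress : ∀ ν ∈ invProb X, soficPressure P σ X u ν = localValue (gibbsRate P σ w) ν :=
    fun ν hν => soficPressure_eq_localValue hV hXc hw hwu hν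
  have heq : ∀ ν ∈ maximizers P σ X w m, IsEquilibrium P σ X u ν := fun ν hν =>
    ⟨hν.1, fun ν' hν' => by
      rw [hpress ν' hν', hpress ν hν.1]
      exact (hmax ν' hν').trans hν.2⟩
  have hFc : IsClosed (maximizers P σ X w m) := isClosed_maximizers hXc m
  obtain ⟨p, hpμ, hpF⟩ := exists_bary_eq_of_approx (μ := μ) hFc fun O N hO hμO hN hFN δ hδ =>
    hμ.exists_bary_mem hσ hXc hw hν₀ (hmν₀ ▸ EReal.bot_lt_coe m) hO hμO hN
      (fun ν hν h => hFN ⟨hν, hmν₀ ▸ h⟩) hδ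
  have hpF' : ∀ᵐ ν ∂(p : Measure (ProbabilityMeasure (Γ → A))), ν ∈ maximizers P σ X w m :=
    mem_ae_iff.2 hpF
  have hpbind : ((p : Measure (ProbabilityMeasure (Γ → A))).bind fun ν => (ν : Measure (Γ → A))) =
      μ := congrArg (fun ρ : ProbabilityMeasure (Γ → A) => (ρ : Measure (Γ → A))) hpμ
  refine ⟨⟨p, inferInstance, hpF'.mono fun ν hν => hν.1, fun f => ?_, hpF'.mono heq⟩,
    ⟨m, ⟨⟨ν₀, hν₀, by rw [hpress ν₀ hν₀, hmν₀]⟩, ?_⟩, ?_⟩, fun hgood => ?_⟩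
  · rw [← integral_bind_toMeasure, hpbind]
  · rintro _ ⟨ν, hν, rfl⟩
    rw [hpress ν hν]
    exact hmax ν hν
  · simp only [expGibbsPressure_eq]
    exact hlim
  · have hμinv : IsInvariant μ := isInvariant_of_bind_eq hpbind (hpF'.mono fun ν hν => hν.1.1)
    obtain ⟨κ, D, hκ, hDm, hμD, hDe, hDbind, hDerg⟩ := hμinv.exists_ergodic_disintegration
    refine ⟨⟨_, isErgodicDecomposition_map hκ hDe hμD (hDbind μ hμinv hμD)⟩, fun θ hθ => ?_⟩
    have hprob := hθ.prob
    have hmeas : MeasurableSet (κ ⁻¹' (maximizers P σ X w m)ᶜ) := hκ hFc.measurableSet.compl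
    -- Goodness is applied to `p`-almost every `ν`, because `μ` itself is not known to be a
    -- maximizer. Almost every `ν` inherits `ν(Dᶜ) = 0` from `μ`, so the same `κ` decomposes it.
    have hμκ : (μ : Measure (Γ → A)) (κ ⁻¹' (maximizers P σ X w m)ᶜ) = 0 := by
      rw [← hpbind, Measure.bind_apply hmeas measurable_toMeasure.aemeasurable,
        lintegral_eq_zero_iff (measurable_probabilityMeasure_apply hmeas)]
      filter_upwards [hpF', ae_ae_of_bind_eq hpbind hμD] with ν hν hνD
      exact hgood.ae_mem_maximizers hV hXc hw hmax hκ hDe hν hνD (hDbind ν hν.1.1 hνD)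
    have hθbind := bind_eq_of_integral_eq hθ.barycenter
    -- An ergodic `ν` in this measurable set would satisfy `κ x = ν` and `κ x ∈ maximizers` for
    -- `ν`-almost every `x`, yet not be a maximizer. Hence the set contains no ergodic measure and
    -- is null for an arbitrary ergodic decomposition `θ`.
    have hE := hθ.ergodic ({ν | IsInvariant ν} ∩ {ν | (ν : Measure (Γ → A)) Dᶜ = 0} ∩
      {ν | (ν : Measure (Γ → A)) (κ ⁻¹' (maximizers P σ X w m)ᶜ) = 0} ∩ (maximizers P σ X w m)ᶜ)
      (((isClosed_isInvariant.measurableSet.inter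
        (measurable_probabilityMeasure_apply hDm.compl (measurableSet_singleton 0))).inter
        (measurable_probabilityMeasure_apply hmeas (measurableSet_singleton 0))).inter
        hFc.measurableSet.compl) (by
          rintro ν ⟨⟨⟨-, h2⟩, h3⟩, h4⟩ hν
          obtain ⟨x, hx1, hx2⟩ := ((hDerg ν hν h2).and
            (measure_eq_zero_iff_ae_notMem.1 h3)).exists
          exact hx2 (by rw [Set.mem_preimage, hx1]; exact h4))
    filter_upwards [measure_eq_zero_iff_ae_notMem.1 hE, hθ.invariant, ae_ae_of_bind_eq hθbind hμD,
      ae_ae_of_bind_eq hθbind hμκ] with ν h1 h2 h3 h4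
    refine heq ν ?_
    by_contra h5
    exact h1 ⟨⟨⟨h2, h3⟩, h4⟩, h5⟩
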